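/- **Setting.** Let $d,k\ge 1$ and $T\ge 1$ be integers, and let $X\subset\mathbb Z^d\times\{0,\dots,T-1\}^k$ be nonempty, $T$-periodic in $e_1,\dots,e_d$, and connected in the following sense: there are a set $\mathcal E\subset X\times X$ and $R>0$ such that any two points $i,j\in X$ are joined by a finite sequence $i=i_0,i_1,\dots,i_N=j$ in $X$ with $(i_n,i_{n+1})\in\mathcal E$; $(i,j)\in\mathcal E$ implies $(i+Te_m,j+Te_m)\in\mathcal E$ for $m=1,\dots,d$; and $|i-j|\le R$ for all $(i,j)\in\mathcal E$. Write $Q_{T,k}=[0,T)^k$, $Q_{T,d}=[0,T)^d$ and $Q^l_{T,d}=lT+[0,T)^d$ for $l\in\mathbb Z^d$. Let $\Omega\subset\mathbb R^d$ be an open set with Lipschitz boundary, and for $\varepsilon>0$ let $$\mathcal L_\varepsilon=\{l\in\mathbb Z^d:\ \mathrm{dist}(\varepsilon T l,\partial\Omega)>2\varepsilon\sqrt d\,T\},\qquad I_\varepsilon=\{l\in\mathbb Z^d:\ \varepsilon Q^l_{T,d}\subset\Omega\}$$ (with $\mathrm{dist}(\cdot,\emptyset)=+\infty$). Given $u_\varepsilon:(\Omega\times\varepsilon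 Q_{T,k})\cap\varepsilon X\to\mathbb R$, write $u^\varepsilon_i=u_\varepsilon(\varepsilon i)$ if $\varepsilon i$ belongs to the domain of $u_\varepsilon$ and $u_i^\varepsilon=0$ otherwise, and set $$\tilde u^l_\varepsilon=\frac1{\#[(Q_{T,d}\times Q_{T,k})\cap X]}\sum_{i\in(Q^l_{T,d}\times Q_{T,k})\cap X}u^\varepsilon_i,\qquad \overline u_\varepsilon=\sum_{l\in I_\varepsilon}\tilde u^l_\varepsilon\,\chi_{\varepsilon Q^l_{T,d}}.$$ **Proposition (Compactness).** Let $M>0$ and let $(u_\varepsilon)_{\varepsilon>0}$ be a family of functions $u_\varepsilon:(\Omega\times\varepsilon Q_{T,k})\cap\varepsilon X\to\mathbb R$ for which there is a constant $C$ such that, for all $\varepsilon>0$, $$\sum_{l\in\mathbb Z^d}\ \sum_{i\in(Q^l_{T,d}\times Q_{T,k})\cap X}\varepsilon^d|u^\varepsilon_i|^2\le C$$ and $$\sum_{\substack{l,l'\in\mathcal L_\varepsilon\\|l-l'|=1}}\ \sum_{i,j\in[(Q^l_{T,d}\cup Q^{l'}_{T,d}+(-M,M)^d)\times Q_{T,k}]\cap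 X}\varepsilon^{d-2}|u^\varepsilon_i-u^\varepsilon_j|^2\le C .$$ Then, up to a subsequence, $\overline u_\varepsilon$ converges strongly in $L^2_{\rm loc}(\Omega)$ to some $u\in H^1(\Omega)$. That is, for every sequence $\varepsilon_n>0$ with $\varepsilon_n\to0$ there are a subsequence $(\varepsilon_{n_j})_j$ and a function $u\in H^1(\Omega)$ such that $\overline u_{\varepsilon_{n_j}}\to u$ in $L^2(K)$ for every compact $K\subset\Omega$. -/

import Mathlib

open Set Filter Topology MeasureTheory
open scoped NNReal ENNReal Pointwise ContDiff

namespace ThinLattice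

noncomputable section

/-- A node `i = (i^d, i^k)` of `ℤ^d × ℤ^k`. -/
abbrev Node (d k : ℕ) : Type := (Fin d → ℤ) × (Fin k → ℤ)

/-- An integer vector seen as a point of Euclidean space. -/
def latPt {n : ℕ} (l : Fin n → ℤ) : EuclideanSpace ℝ (Fin n) :=
  WithLp.toLp 2 (fun m => (l m : ℝ))

/-- The translation `i ↦ i + T e_m`, for one of the first `d` directions. -/
def shift {d k : ℕ} (T : ℕ) (m : Fin d) (i : Node d k) : Node d k :=
  (i.1 + Pi.single m (T : ℤ), i.2)

/-- The assumptions on `X`: a nonempty subset of `ℤ^d × {0, …, T-1}^k`, `T`-periodic in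
`e_1, …, e_d`, and connected through a `T`-periodic set of edges of bounded range. -/
structure IsAdmissible {d k : ℕ} (T : ℕ) (X : Set (Node d k)) : Prop where
  period_pos : 1 ≤ T
  nonempty : X.Nonempty
  bounded : ∀ i ∈ X, ∀ n, 0 ≤ i.2 n ∧ i.2 n ≤ (T : ℤ) - 1
  periodic : ∀ (m : Fin d) (i : Node d k), shift T m i ∈ X ↔ i ∈ X
  connected : ∃ E : Set (Node d k × Node d k),
    E ⊆ X ×ˢ X ∧
    (∀ i ∈ X, ∀ j ∈ X, Relation.ReflTransGen (fun a b => (a, b) ∈ E) i j) ∧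
    (∀ i j, (i, j) ∈ E → ∀ m : Fin d, (shift T m i, shift T m j) ∈ E) ∧
    ∃ R : ℝ, 0 < R ∧ ∀ i j, (i, j) ∈ E →
      Real.sqrt (dist (latPt i.1) (latPt j.1) ^ 2 + dist (latPt i.2) (latPt j.2) ^ 2) ≤ R

/-- The semi-open cube `Q_T^l = l T + [0, T)^n`. -/
def cube {n : ℕ} (T : ℕ) (l : Fin n → ℤ) : Set (EuclideanSpace ℝ (Fin n)) :=
  {x | ∀ m, x m ∈ Ico ((l m : ℝ) * T) ((l m : ℝ) * T + T)}

/-- The open cube `(-M, M)^n`. -/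
def openBox (n : ℕ) (M : ℝ) : Set (EuclideanSpace ℝ (Fin n)) :=
  {x | ∀ m, x m ∈ Ioo (-M) M}

/-- `(A × Q_{T,k}) ∩ X`, as a set of nodes. -/
def nodesIn {d k : ℕ} (T : ℕ) (X : Set (Node d k)) (A : Set (EuclideanSpace ℝ (Fin d))) :
    Set (Node d k) :=
  {i | i ∈ X ∧ latPt i.1 ∈ A ∧ latPt i.2 ∈ cube T (0 : Fin k → ℤ)}

/-- `(Ω × ε Q_{T,k}) ∩ ε X`, a subset of `ℝ^d × ℝ^k`. -/
def scaledNodes {d k : ℕ} (T : ℕ) (X : Set (Node d k)) (Ω : Set (EuclideanSpace ℝ (Fin d)))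
    (ε : ℝ) : Set (EuclideanSpace ℝ (Fin d) × EuclideanSpace ℝ (Fin k)) :=
  (Ω ×ˢ (ε • cube T (0 : Fin k → ℤ))) ∩
    (fun i : Node d k => (ε • latPt i.1, ε • latPt i.2)) '' X

open Classical in
/-- The values `u_i = u (ε i)`, set to be zero at nodes where `u` is not defined. -/
def nodeVal {d k : ℕ} {T : ℕ} {X : Set (Node d k)} {Ω : Set (EuclideanSpace ℝ (Fin d))}
    {ε : ℝ} (u : scaledNodes T X Ω ε → ℝ) (i : Node d k) : ℝ :=
  if h : (ε • latPt i.1, ε • latPt i.2) ∈ scaledNodes T X Ω ε then u ⟨_, h⟩ else 0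

theorem finite_nodesIn_cube {d k : ℕ} (T : ℕ) (X : Set (Node d k)) (l : Fin d → ℤ) :
    (nodesIn T X (cube T l)).Finite := by
  refine ((Set.finite_Icc (fun m => l m * T) (fun m => l m * T + T)).prod
    (Set.finite_Icc (0 : Fin k → ℤ) (fun _ => (T : ℤ)))).subset ?_
  rintro ⟨a, b⟩ ⟨-, ha, hb⟩
  refine ⟨⟨fun m => ?_, fun m => ?_⟩, ⟨fun m => ?_, fun m => ?_⟩⟩
  · have h := (ha m).1
    simp only [latPt] at h
    exact_mod_cast h
  · have h := (ha m).2.le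
    simp only [latPt] at h
    exact_mod_cast h
  · have h := (hb m).1
    simp only [latPt, Pi.zero_apply, Int.cast_zero, zero_mul] at h
    exact_mod_cast h
  · have h := (hb m).2.le
    simp only [latPt, Pi.zero_apply, Int.cast_zero, zero_mul, zero_add] at h
    exact_mod_cast h

/-- The cell average `ũ^l`: the sum of `v` over the nodes of `X` in `Q_T^l × Q_{T,k}`, divided by
the number of nodes of `X` in `Q_T × Q_{T,k}`. -/
def cellAvg {d k : ℕ} (T : ℕ) (X : Set (Node d k)) (v : Node d k → ℝ) (l : Fin d → ℤ) : ℝ :=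
  ((nodesIn T X (cube T (0 : Fin d → ℤ))).ncard : ℝ)⁻¹ *
    ∑ i ∈ (finite_nodesIn_cube T X l).toFinset, v i

/-- `I_ε`: the cells `l` with `ε Q_T^l ⊆ Ω`. -/
def innerCells {d : ℕ} (T : ℕ) (Ω : Set (EuclideanSpace ℝ (Fin d))) (ε : ℝ) :
    Set (Fin d → ℤ) :=
  {l | ε • cube T l ⊆ Ω}

/-- `L_ε`: the cells `l` whose base point `ε T l` has distance more than `2 ε √d T` from `∂Ω`
(the distance from the empty set is `∞`). -/
def farCells {d : ℕ} (T : ℕ) (Ω : Set (EuclideanSpace ℝ (Fin d))) (ε : ℝ) :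
    Set (Fin d → ℤ) :=
  {l | ENNReal.ofReal (2 * ε * Real.sqrt d * T) <
    Metric.infEDist ((ε * T) • latPt l) (frontier Ω)}

/-- The piecewise constant function `ū_ε = ∑_{l ∈ I_ε} ũ^l χ_{ε Q_T^l}`; at every point at most
one term of the sum is nonzero. -/
def uBar {d k : ℕ} {T : ℕ} {X : Set (Node d k)} {Ω : Set (EuclideanSpace ℝ (Fin d))}
    {ε : ℝ} (u : scaledNodes T X Ω ε → ℝ) (x : EuclideanSpace ℝ (Fin d)) : ℝ :=
  ∑ᶠ (l : Fin d → ℤ) (_ : l ∈ innerCells T Ω ε),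
    (ε • cube T l).indicator (fun _ => cellAvg T X (nodeVal u) l) x

/-- `∑_{l ∈ ℤ^d} ∑_{i ∈ (Q_T^l × Q_{T,k}) ∩ X} ε^d |u_i|^2`. -/
def massSum {d k : ℕ} {T : ℕ} {X : Set (Node d k)} {Ω : Set (EuclideanSpace ℝ (Fin d))}
    {ε : ℝ} (u : scaledNodes T X Ω ε → ℝ) : ℝ≥0∞ :=
  ∑' (l : Fin d → ℤ) (i : nodesIn T X (cube T l)),
    ENNReal.ofReal (ε ^ d * |nodeVal u i| ^ 2)

/-- The pairs of nearest neighbours in `L_ε × L_ε`, in the Euclidean sense `|l - l'| = 1`. -/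
def nnPairs {d : ℕ} (T : ℕ) (Ω : Set (EuclideanSpace ℝ (Fin d))) (ε : ℝ) :
    Set ((Fin d → ℤ) × (Fin d → ℤ)) :=
  {p | p.1 ∈ farCells T Ω ε ∧ p.2 ∈ farCells T Ω ε ∧ dist (latPt p.1) (latPt p.2) = 1}

/-- `((Q_T^l ∪ Q_T^{l'} + (-M, M)^d) × Q_{T,k}) ∩ X`. -/
def pairNodes {d k : ℕ} (T : ℕ) (X : Set (Node d k)) (M : ℝ) (l l' : Fin d → ℤ) :
    Set (Node d k) :=
  nodesIn T X ((cube T l ∪ cube T l') + openBox d M)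

/-- `∑_{l, l' ∈ L_ε, |l - l'| = 1} ∑_{i, j} ε^{d-2} |u_i - u_j|^2`, the inner sum over
`i, j ∈ ((Q_T^l ∪ Q_T^{l'} + (-M, M)^d) × Q_{T,k}) ∩ X`. -/
def nnEnergy {d k : ℕ} {T : ℕ} {X : Set (Node d k)} {Ω : Set (EuclideanSpace ℝ (Fin d))}
    {ε : ℝ} (M : ℝ) (u : scaledNodes T X Ω ε → ℝ) : ℝ≥0∞ :=
  ∑' (p : nnPairs T Ω ε) (i : pairNodes T X M p.1.1 p.1.2) (j : pairNodes T X M p.1.1 p.1.2),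
    ENNReal.ofReal (ε ^ ((d : ℤ) - 2) * |nodeVal u i - nodeVal u j| ^ 2)

/-- Lipschitz boundary: near every boundary point, `Ω` is the region strictly on one side of the
graph of a Lipschitz function over the hyperplane orthogonal to some unit vector `e`. -/
def HasLipschitzBoundary {d : ℕ} (Ω : Set (EuclideanSpace ℝ (Fin d))) : Prop :=
  ∀ x ∈ frontier Ω, ∃ (r : ℝ) (e : EuclideanSpace ℝ (Fin d)) (K : ℝ≥0)
    (g : EuclideanSpace ℝ (Fin d) → ℝ), 0 < r ∧ ‖e‖ = 1 ∧ LipschitzWith K g ∧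
      ∀ y ∈ Metric.ball x r, (y ∈ Ω ↔ inner ℝ e y < g (y - (inner ℝ e y : ℝ) • e))

/-- `u ∈ H^1(Ω)`: `u` and its weak gradient `G` belong to `L^2(Ω)`. -/
def MemH1 {d : ℕ} (Ω : Set (EuclideanSpace ℝ (Fin d))) (u : EuclideanSpace ℝ (Fin d) → ℝ) :
    Prop :=
  MemLp u 2 (volume.restrict Ω) ∧
  ∃ G : EuclideanSpace ℝ (Fin d) → EuclideanSpace ℝ (Fin d),
    MemLp G 2 (volume.restrict Ω) ∧
    ∀ φ : EuclideanSpace ℝ (Fin d) → ℝ, ContDiff ℝ ∞ φ → HasCompactSupport φ →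
      tsupport φ ⊆ Ω → ∀ m : Fin d,
        ∫ x in Ω, u x * fderiv ℝ φ x (EuclideanSpace.single m 1) = -∫ x in Ω, G x m * φ x

/-- Strong convergence `f_n → u` in `L^2_loc(Ω)`: in `L^2(K)` for all compact `K ⊆ Ω`. -/
def TendstoL2Loc {d : ℕ} (Ω : Set (EuclideanSpace ℝ (Fin d)))
    (f : ℕ → EuclideanSpace ℝ (Fin d) → ℝ) (u : EuclideanSpace ℝ (Fin d) → ℝ) : Prop :=
  ∀ K : Set (EuclideanSpace ℝ (Fin d)), IsCompact K → K ⊆ Ω →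
    (∀ n, MemLp (f n) 2 (volume.restrict K)) ∧ MemLp u 2 (volume.restrict K) ∧
    Tendsto (fun n => eLpNorm (fun x => f n x - u x) 2 (volume.restrict K)) atTop (𝓝 0)

end

end ThinLattice

/-!
The cell averages form a function on `ℤ^d`, and `ū_ε` is the corresponding piecewise constant
function on cells of side `h = ε T`. By Jensen's inequality the first bound makes `ū_ε` bounded in
`L²(ℝ^d)`. The difference of two neighbouring averages is the average of `u_i - u_j` over all pairs
of nodes, one from each cell, and all these pairs occur in the energy; hence the difference quotients
of the averages (`cellGrad`), set to zero near the boundary, are bounded in `L²(ℝ^d)` too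
(`IsAdmissible.tsum_cellGrad_le`).

Along a subsequence both families converge weakly in `L²(ℝ^d)`, to `v` and `G`. On a neighbourhood of
a compact subset of `Ω` the discrete gradient is, for small `ε`, the difference quotient of `ū_ε` with
step `h` (`uBar_add_single_sub`). Moving the difference quotient onto a test function shows that `G`
is the weak gradient of `v` (`integral_mul_fderiv_eq_of_weak`), so `v ∈ H¹(Ω)`.

For strong convergence on a compact `K ⊆ Ω`, moving by a vector with coordinates in `[0, H]` crosses at
most `H / h + 1` cell walls in each direction, so it changes `ū_ε` in `L²(K)` by at most
`d (H + h)` times the norm of the discrete gradient (`eLpNorm_translate_sub_le`). Averages over small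
boxes therefore approximate `ū_ε` uniformly in `ε`, and these averages converge strongly because of
the weak convergence (`tendsto_eLpNorm_restrict_of_weak_of_translate`).
-/

namespace ThinLattice

section

/-! ### Weak compactness and translations in `L²` -/

/-- A bounded sequence in a separable Hilbert space has a weakly convergent subsequence: the
sequential Banach–Alaoglu theorem, transported through the Riesz isomorphism. -/
theorem exists_subseq_tendsto_inner {H : Type*} [NormedAddCommGroup H] [InnerProductSpace ℝ H]
    [CompleteSpace H] [SecondCountableTopology H] (x : ℕ → H) (B : ℝ) (hx : ∀ n, ‖x n‖ ≤ B) :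
    ∃ (y : H) (s : ℕ → ℕ), StrictMono s ∧
      ∀ z, Tendsto (fun n => inner ℝ (x (s n)) z) atTop (𝓝 (inner ℝ y z)) := by
  let D : H → WeakDual ℝ H := fun a => StrongDual.toWeakDual (InnerProductSpace.toDual ℝ H a)
  have hmem : ∀ n, D (x n) ∈ WeakDual.toStrongDual ⁻¹' Metric.closedBall (0 : StrongDual ℝ H) B := by
    intro n
    simpa [D] using hx n
  obtain ⟨ℓ, -, s, hs, hlim⟩ := WeakDual.isSeqCompact_closedBall ℝ H 0 B hmem
  refine ⟨(InnerProductSpace.toDual ℝ H).symm (WeakDual.toStrongDual ℓ), s, hs, fun z => ?_⟩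
  have h := ((WeakDual.eval_continuous z).tendsto ℓ).comp hlim
  rw [InnerProductSpace.toDual_symm_apply]
  exact h

/-- Weak sequential compactness of bounded sets of `L²` functions, stated for functions rather than
classes; the limit has a strongly measurable representative. -/
theorem exists_subseq_tendsto_integral_inner {α V : Type*} [MeasurableSpace α]
    [MeasurableSpace.CountablyGenerated α] {μ : Measure α} [SFinite μ]
    [NormedAddCommGroup V] [InnerProductSpace ℝ V] [CompleteSpace V] [SecondCountableTopology V]
    (f : ℕ → α → V) (hf : ∀ n, MemLp (f n) 2 μ) (B : ℝ≥0)
    (hB : ∀ n, eLpNorm (f n) 2 μ ≤ B) :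
    ∃ (u : α → V) (s : ℕ → ℕ), StrictMono s ∧ StronglyMeasurable u ∧ MemLp u 2 μ ∧
      ∀ w : α → V, MemLp w 2 μ →
        Tendsto (fun n => ∫ x, inner ℝ (f (s n) x) (w x) ∂μ) atTop
          (𝓝 (∫ x, inner ℝ (u x) (w x) ∂μ)) := by
  have : Fact ((2 : ℝ≥0∞) ≠ ⊤) := ⟨by simp⟩
  obtain ⟨y, s, hs, hy⟩ := exists_subseq_tendsto_inner (fun n => (hf n).toLp (f n)) B (by
    intro n
    rw [Lp.norm_toLp]
    exact ENNReal.toReal_le_coe_of_le_coe (hB n))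
  refine ⟨y, s, hs, Lp.stronglyMeasurable y, Lp.memLp y, fun w hw => ?_⟩
  have h := hy (hw.toLp w)
  simp only [L2.inner_def] at h
  have e : ∫ a, inner ℝ (y a) (hw.toLp w a) ∂μ = ∫ a, inner ℝ (y a) (w a) ∂μ := by
    refine integral_congr_ae ?_
    filter_upwards [hw.coeFn_toLp] with a h2
    rw [h2]
  rw [e] at h
  refine h.congr fun n => integral_congr_ae ?_
  filter_upwards [(hf (s n)).coeFn_toLp, hw.coeFn_toLp] with a h1 h2
  rw [h1, h2]

variable {E : Type*} [NormedAddCommGroup E] [InnerProductSpace ℝ E] [FiniteDimensional ℝ E]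
  [MeasurableSpace E] [BorelSpace E]

theorem eLpNorm_comp_add_right {V : Type*} [NormedAddCommGroup V] {f : E → V} (p : ℝ≥0∞)
    (hf : AEStronglyMeasurable f volume) (z : E) :
    eLpNorm (fun x => f (x + z)) p volume = eLpNorm f p volume :=
  eLpNorm_comp_measurePreserving hf (measurePreserving_add_right volume z)

theorem memLp_comp_add_right {V : Type*} [NormedAddCommGroup V] {f : E → V} {p : ℝ≥0∞}
    (hf : MemLp f p volume) (z : E) : MemLp (fun x => f (x + z)) p volume :=
  hf.comp_measurePreserving (measurePreserving_add_right volume z)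

/-- Translation is continuous in `L²`. -/
theorem tendsto_eLpNorm_translate_sub {f : E → ℝ} (hf : MemLp f 2 volume) :
    Tendsto (fun z : E => eLpNorm (fun x => f (x + z) - f x) 2 volume) (𝓝 0) (𝓝 0) := by
  have : Fact ((2 : ℝ≥0∞) ≠ ⊤) := ⟨by simp⟩
  have hc : Continuous fun z : E => DomAddAct.mk z +ᵥ hf.toLp f :=
    (DomAddAct.continuous_mk (M := E)).vadd continuous_const
  have h := (hc.edist (continuous_const (y := hf.toLp f))).tendsto 0
  simp only [DomAddAct.mk_zero, zero_vadd, edist_self] at h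
  refine h.congr fun z => ?_
  rw [DomAddAct.mk_vadd_toLp, Lp.edist_toLp_toLp]
  refine eLpNorm_congr_ae (Eventually.of_forall fun x => ?_)
  simp [add_comm]

end

section

/-! ### A local Kolmogorov–Riesz theorem -/

theorem eLpNorm_two_sq {α V : Type*} [MeasurableSpace α] {μ : Measure α} [NormedAddCommGroup V]
    (f : α → V) : eLpNorm f 2 μ ^ 2 = ∫⁻ x, ‖f x‖ₑ ^ 2 ∂μ := by
  have h := eLpNorm_nnreal_pow_eq_lintegral (p := 2) (f := f) (μ := μ) (by norm_num)
  simpa using h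

theorem eLpNorm_two_le_iff {α V : Type*} [MeasurableSpace α] {μ : Measure α}
    [NormedAddCommGroup V] (f : α → V) (δ : ℝ≥0∞) :
    eLpNorm f 2 μ ≤ δ ↔ ∫⁻ x, ‖f x‖ₑ ^ 2 ∂μ ≤ δ ^ 2 := by
  rw [← eLpNorm_two_sq]
  exact (ENNReal.pow_le_pow_left_iff two_ne_zero).symm

theorem tendsto_eLpNorm_two_zero {α V ι : Type*} [MeasurableSpace α] {μ : Measure α}
    [NormedAddCommGroup V] {l : Filter ι} {f : ι → α → V}
    (h : Tendsto (fun n => ∫⁻ x, ‖f n x‖ₑ ^ 2 ∂μ) l (𝓝 0)) :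
    Tendsto (fun n => eLpNorm (f n) 2 μ) l (𝓝 0) := by
  rw [ENNReal.tendsto_nhds_zero] at h ⊢
  intro δ hδ
  filter_upwards [h (δ ^ 2) (ENNReal.pow_pos hδ 2)] with n hn
  rwa [eLpNorm_two_le_iff]

variable {E : Type*} [NormedAddCommGroup E] [InnerProductSpace ℝ E] [FiniteDimensional ℝ E]
  [MeasurableSpace E] [BorelSpace E]

/-- Averaging translates moves a function in `L²(μ)` no further than the worst translate: Jensen's
inequality in the translation variable, then Tonelli's theorem. -/
theorem eLpNorm_average_translate_sub_le {ν μ : Measure E} [IsProbabilityMeasure ν] [SFinite μ]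
    {f : E → ℝ} (hfm : Measurable f) (hint : ∀ x, Integrable (fun z => f (x + z)) ν) {δ : ℝ≥0∞}
    (h : ∀ᵐ z ∂ν, eLpNorm (fun x => f (x + z) - f x) 2 μ ≤ δ) :
    eLpNorm (fun x => ∫ z, f (x + z) ∂ν - f x) 2 μ ≤ δ := by
  rw [eLpNorm_two_le_iff]
  have hm : Measurable fun p : E × E => ‖f (p.1 + p.2) - f p.1‖ₑ ^ 2 := by fun_prop
  have jensen : ∀ x, ‖∫ z, f (x + z) ∂ν - f x‖ₑ ^ 2 ≤ ∫⁻ z, ‖f (x + z) - f x‖ₑ ^ 2 ∂ν := by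
    intro x
    have h1 : ∫ z, f (x + z) ∂ν - f x = ∫ z, (f (x + z) - f x) ∂ν := by
      rw [integral_sub (hint x) (integrable_const _)]
      simp
    rw [h1, ← eLpNorm_two_sq]
    gcongr
    refine (enorm_integral_le_lintegral_enorm _).trans ?_
    rw [← eLpNorm_one_eq_lintegral_enorm]
    exact eLpNorm_le_eLpNorm_of_exponent_le (by norm_num)
      (by fun_prop : Measurable _).aestronglyMeasurable
  calc ∫⁻ x, ‖∫ z, f (x + z) ∂ν - f x‖ₑ ^ 2 ∂μ
      ≤ ∫⁻ x, ∫⁻ z, ‖f (x + z) - f x‖ₑ ^ 2 ∂ν ∂μ := lintegral_mono jensen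
    _ = ∫⁻ z, ∫⁻ x, ‖f (x + z) - f x‖ₑ ^ 2 ∂μ ∂ν := lintegral_lintegral_swap hm.aemeasurable
    _ ≤ ∫⁻ _, δ ^ 2 ∂ν := by
        refine lintegral_mono_ae ?_
        filter_upwards [h] with z hz
        rwa [eLpNorm_two_le_iff] at hz
    _ = δ ^ 2 := by simp

/-- A local Kolmogorov–Riesz theorem: on a set of finite measure, a weakly convergent sequence in
`L²` which is equicontinuous under translations by the points of arbitrarily small sets of positive
measure converges strongly. Averages over such a set converge pointwise, by weak convergence, and
stay bounded, so they converge in `L²(K)`. -/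
theorem tendsto_eLpNorm_restrict_of_weak_of_translate {f : ℕ → E → ℝ} {u : E → ℝ}
    (hfm : ∀ n, Measurable (f n)) (hf : ∀ n, MemLp (f n) 2 volume)
    (hum : Measurable u) (hu : MemLp u 2 volume) {B : ℝ≥0}
    (hB : ∀ n, eLpNorm (f n) 2 volume ≤ B)
    (hweak : ∀ w : E → ℝ, MemLp w 2 volume →
      Tendsto (fun n => ∫ x, f n x * w x) atTop (𝓝 (∫ x, u x * w x)))
    {K : Set E} (hK : volume K ≠ ⊤)
    (htrans : ∀ δ : ℝ≥0∞, 0 < δ → ∀ r : ℝ, 0 < r → ∃ S ⊆ Metric.ball (0 : E) r,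
      MeasurableSet S ∧ volume S ≠ 0 ∧ ∀ᶠ n in atTop, ∀ z ∈ S,
        eLpNorm (fun x => f n (x + z) - f n x) 2 (volume.restrict K) ≤ δ) :
    Tendsto (fun n => eLpNorm (fun x => f n x - u x) 2 (volume.restrict K)) atTop (𝓝 0) := by
  rw [ENNReal.tendsto_nhds_zero]
  intro η hη
  obtain ⟨δ, hδ, hδη⟩ : ∃ δ : ℝ≥0∞, 0 < δ ∧ δ + (δ + δ) ≤ η := by
    refine ⟨η / 3, ENNReal.div_pos hη.ne' (by simp), ?_⟩
    rw [← add_assoc, ENNReal.add_thirds]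
  obtain ⟨r, hr, hru⟩ := Metric.eventually_nhds_iff_ball.1
    (ENNReal.tendsto_nhds_zero.1 (tendsto_eLpNorm_translate_sub hu) δ hδ)
  obtain ⟨S, hSr, hSm, hS0, hSf⟩ := htrans δ hδ r hr
  have hStop : volume S ≠ ⊤ :=
    ne_top_of_le_ne_top Metric.isBounded_ball.measure_lt_top.ne (measure_mono hSr)
  have : IsFiniteMeasure (volume.restrict K) := ⟨by simpa using hK.lt_top⟩
  set ν : Measure E := (volume S)⁻¹ • volume.restrict S with hν
  have : IsProbabilityMeasure ν := by
    constructor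
    simp [hν, ENNReal.inv_mul_cancel hS0 hStop]
  have hνS : ∀ᵐ z ∂ν, z ∈ S := Measure.ae_smul_measure (ae_restrict_mem hSm) _
  have hmem : ∀ g : E → ℝ, MemLp g 2 volume → ∀ x, MemLp (fun z => g (x + z)) 2 ν := by
    intro g hg x
    have h := memLp_comp_add_right hg x
    simp only [add_comm _ x] at h
    exact (h.restrict S).smul_measure (ENNReal.inv_ne_top.2 hS0)
  have hint : ∀ g : E → ℝ, MemLp g 2 volume → ∀ x, Integrable (fun z => g (x + z)) ν :=
    fun g hg x => (hmem g hg x).integrable (by norm_num)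
  set A : (E → ℝ) → E → ℝ := fun g x => ∫ z, g (x + z) ∂ν with hA
  have hAm : ∀ g : E → ℝ, Measurable g → Measurable (A g) := by
    intro g hg
    have h : StronglyMeasurable (Function.uncurry fun x z : E => g (x + z)) :=
      (by unfold Function.uncurry; fun_prop : Measurable _).stronglyMeasurable
    exact h.integral_prod_right.measurable
  -- an average at `x` is the integral against the normalized indicator of `x + S`
  have hAw : ∀ (g : E → ℝ) (x : E),
      A g x = ∫ y, g y * (S.indicator (fun _ => (volume S).toReal⁻¹) (y - x)) := by
    intro g x
    rw [← integral_add_right_eq_self _ x]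
    simp only [hA, hν, integral_smul_measure, add_sub_cancel_right]
    rw [← integral_indicator hSm, ENNReal.toReal_inv, smul_eq_mul, ← integral_const_mul]
    congr 1
    ext z
    by_cases hz : z ∈ S <;> simp [hz, add_comm x z, mul_comm]
  have hAlim : ∀ x, Tendsto (fun n => A (f n) x) atTop (𝓝 (A u x)) := by
    intro x
    simp only [hAw]
    refine hweak _ ?_
    have h := memLp_indicator_const 2 hSm ((volume S).toReal⁻¹) (Or.inr hStop)
    simpa only [sub_eq_add_neg] using memLp_comp_add_right h (-x)
  -- the averages are bounded, which gives the dominating constant on the finite-measure set `K`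
  obtain ⟨c, hc⟩ : ∃ c : ℝ≥0∞, c ≠ ⊤ ∧ ∀ (g : E → ℝ), MemLp g 2 volume → ∀ x,
      ‖A g x‖ₑ ≤ c * eLpNorm g 2 volume := by
    refine ⟨(volume S)⁻¹ ^ (1 / (2 : ℝ≥0∞)).toReal, ?_, fun g hg x => ?_⟩
    · exact ENNReal.rpow_ne_top_of_nonneg (by simp) (ENNReal.inv_ne_top.2 hS0)
    calc ‖A g x‖ₑ ≤ eLpNorm (fun z => g (x + z)) 1 ν := by
          rw [eLpNorm_one_eq_lintegral_enorm]
          exact enorm_integral_le_lintegral_enorm _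
      _ ≤ eLpNorm (fun z => g (x + z)) 2 ν :=
          eLpNorm_le_eLpNorm_of_exponent_le (by norm_num) (hmem g hg x).1
      _ ≤ (volume S)⁻¹ ^ (1 / (2 : ℝ≥0∞)).toReal * eLpNorm (fun z => g (x + z)) 2 volume := by
          rw [hν, eLpNorm_smul_measure_of_ne_top (by simp), smul_eq_mul]
          gcongr
          exact Measure.restrict_le_self
      _ = _ := by
          simp only [add_comm x]
          rw [eLpNorm_comp_add_right 2 hg.1]
  have hAstrong : Tendsto (fun n => eLpNorm (fun x => A (f n) x - A u x) 2 (volume.restrict K))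
      atTop (𝓝 0) := by
    have h : Tendsto (fun n => ∫⁻ x in K, ‖A (f n) x - A u x‖ₑ ^ 2) atTop (𝓝 (∫⁻ x in K, 0)) := by
      refine tendsto_lintegral_of_dominated_convergence
        (fun _ => (c * B + c * eLpNorm u 2 volume) ^ 2) (fun n => ?_) (fun n => ?_) ?_ ?_
      · exact (((hAm _ (hfm n)).sub (hAm _ hum)).enorm).pow_const 2
      · refine Eventually.of_forall fun x => ?_
        simp only
        gcongr
        refine (enorm_sub_le).trans ?_
        gcongr
        · exact (hc.2 _ (hf n) x).trans (by gcongr; exact hB n)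
        · exact hc.2 _ hu x
      · rw [lintegral_const]
        refine ENNReal.mul_ne_top (ENNReal.pow_ne_top ?_) (measure_ne_top _ _)
        exact ENNReal.add_ne_top.2
          ⟨ENNReal.mul_ne_top hc.1 (by simp), ENNReal.mul_ne_top hc.1 hu.2.ne⟩
      · refine Eventually.of_forall fun x => ?_
        have h1 := ((hAlim x).sub_const (A u x)).enorm
        replace h1 := ((ENNReal.continuous_pow 2).tendsto _).comp h1
        simpa [Function.comp_def] using h1
    rw [lintegral_zero] at h
    exact tendsto_eLpNorm_two_zero h
  filter_upwards [hSf, ENNReal.tendsto_nhds_zero.1 hAstrong δ hδ] with n hn1 hn2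
  have e1 : eLpNorm (fun x => A (f n) x - f n x) 2 (volume.restrict K) ≤ δ :=
    eLpNorm_average_translate_sub_le (hfm n) (hint _ (hf n)) (hνS.mono hn1)
  have e2 : eLpNorm (fun x => A u x - u x) 2 (volume.restrict K) ≤ δ := by
    refine eLpNorm_average_translate_sub_le hum (hint _ hu) (hνS.mono fun z hz => ?_)
    exact (eLpNorm_mono_measure _ Measure.restrict_le_self).trans (hru z (hSr hz))
  have e : (fun x => f n x - u x) = (fun x => f n x - A (f n) x) +
      ((fun x => A (f n) x - A u x) + fun x => A u x - u x) := by
    ext x; simp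
  rw [e]
  have ms : ∀ g g' : E → ℝ, Measurable g → Measurable g' →
      AEStronglyMeasurable (fun x => g x - g' x) (volume.restrict K) :=
    fun g g' h h' => (h.sub h').aestronglyMeasurable
  refine (eLpNorm_add_le (ms _ _ (hfm n) (hAm _ (hfm n)))
    ((ms _ _ (hAm _ (hfm n)) (hAm _ hum)).add (ms _ _ (hAm _ hum) hum)) (by norm_num)).trans ?_
  refine le_trans ?_ hδη
  gcongr
  · rw [← eLpNorm_neg]
    simpa [Pi.neg_def] using e1
  · refine (eLpNorm_add_le (ms _ _ (hAm _ (hfm n)) (hAm _ hum)) (ms _ _ (hAm _ hum) hum)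
      (by norm_num)).trans ?_
    gcongr

end

section

/-! ### Cells of the lattice -/

variable {d k : ℕ}

/-- The index `l` of the semi-open cell `h l + [0, h)^d` that contains `x`. -/
noncomputable def cellIdx (h : ℝ) (x : EuclideanSpace ℝ (Fin d)) : Fin d → ℤ :=
  fun m => ⌊x m / h⌋

theorem measurable_cellIdx (h : ℝ) : Measurable (cellIdx (d := d) h) := by
  refine measurable_pi_lambda _ fun m => Int.measurable_floor.comp ?_
  fun_prop

theorem cellIdx_eq_iff {h : ℝ} (hh : 0 < h) (x : EuclideanSpace ℝ (Fin d)) (l : Fin d → ℤ) :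
    cellIdx h x = l ↔ ∀ m, x m ∈ Ico (l m * h) (l m * h + h) := by
  simp only [funext_iff, cellIdx, Int.floor_eq_iff, mem_Ico, le_div_iff₀ hh, div_lt_iff₀ hh,
    add_mul, one_mul]

theorem mem_smul_cube_iff {ε : ℝ} (hε : 0 < ε) {T : ℕ} (hT : 1 ≤ T) (l : Fin d → ℤ)
    (x : EuclideanSpace ℝ (Fin d)) : x ∈ ε • cube T l ↔ cellIdx (ε * T) x = l := by
  have hT' : (0 : ℝ) < T := by exact_mod_cast hT
  rw [cellIdx_eq_iff (by positivity), mem_smul_set_iff_inv_smul_mem₀ hε.ne']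
  refine forall_congr' fun m => ?_
  simp only [PiLp.smul_apply, smul_eq_mul, mem_Ico, inv_mul_eq_div, le_div_iff₀ hε,
    div_lt_iff₀ hε]
  ring_nf

theorem volume_preimage_cellIdx {h : ℝ} (hh : 0 < h) (l : Fin d → ℤ) :
    volume (cellIdx h ⁻¹' {l} : Set (EuclideanSpace ℝ (Fin d))) = ENNReal.ofReal (h ^ d) := by
  have e : (cellIdx h ⁻¹' {l} : Set (EuclideanSpace ℝ (Fin d))) =
      WithLp.ofLp ⁻¹' (Set.pi univ fun m => Ico (l m * h) (l m * h + h)) := by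
    ext x
    simp [cellIdx_eq_iff hh]
  rw [e, (PiLp.volume_preserving_ofLp (Fin d)).measure_preimage
    (MeasurableSet.univ_pi fun _ => measurableSet_Ico).nullMeasurableSet, Real.volume_pi_Ico]
  simp [ENNReal.ofReal_pow hh.le]

theorem lintegral_comp_cellIdx {h : ℝ} (hh : 0 < h) (F : (Fin d → ℤ) → ℝ≥0∞) :
    ∫⁻ x, F (cellIdx h x) = ∑' l, F l * ENNReal.ofReal (h ^ d) := by
  rw [← lintegral_map (f := F) (measurable_of_countable F) (measurable_cellIdx h),
    lintegral_countable']
  simp_rw [Measure.map_apply (measurable_cellIdx h) (measurableSet_singleton _),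
    volume_preimage_cellIdx hh]

theorem eLpNorm_comp_cellIdx_le {V : Type*} [NormedAddCommGroup V] {h : ℝ} (hh : 0 < h)
    (a : (Fin d → ℤ) → V) {B : ℝ≥0} (hB : ∑' l, ENNReal.ofReal (h ^ d * ‖a l‖ ^ 2) ≤ B ^ 2) :
    eLpNorm (fun x : EuclideanSpace ℝ (Fin d) => a (cellIdx h x)) 2 volume ≤ B := by
  rw [eLpNorm_two_le_iff, lintegral_comp_cellIdx hh fun l => ‖a l‖ₑ ^ 2]
  refine le_trans (le_of_eq ?_) hB
  congr 1
  ext l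
  rw [mul_comm, ENNReal.ofReal_mul (by positivity), ENNReal.ofReal_pow (norm_nonneg _),
    ofReal_norm]

theorem cellIdx_add_single {h : ℝ} (hh : 0 < h) (x : EuclideanSpace ℝ (Fin d)) (m : Fin d) :
    cellIdx h (x + EuclideanSpace.single m h) = cellIdx h x + Pi.single m 1 := by
  ext m'
  by_cases hm : m' = m
  · subst hm
    simp [cellIdx, add_div, hh.ne']
  · simp [cellIdx, hm]

theorem cellIdx_add_single_of_lt {h r : ℝ} (hr : 0 ≤ r) (hrh : r < h)
    (x : EuclideanSpace ℝ (Fin d)) (m : Fin d) :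
    cellIdx h (x + EuclideanSpace.single m r) = cellIdx h x ∨
      cellIdx h (x + EuclideanSpace.single m r) = cellIdx h x + Pi.single m 1 := by
  have hh : 0 < h := hr.trans_lt hrh
  have key : ⌊(x m + r) / h⌋ = ⌊x m / h⌋ ∨ ⌊(x m + r) / h⌋ = ⌊x m / h⌋ + 1 := by
    have h1 : ⌊x m / h⌋ ≤ ⌊(x m + r) / h⌋ := by gcongr; linarith
    have h2 : ⌊(x m + r) / h⌋ ≤ ⌊x m / h⌋ + 1 := by
      rw [← Int.floor_add_one]
      gcongr
      rw [add_div]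
      gcongr
      exact (div_le_one hh).2 hrh.le
    omega
  refine key.imp (fun e => ?_) (fun e => ?_) <;>
  · ext m'
    by_cases hm : m' = m
    · subst hm
      simpa [cellIdx] using e
    · simp [cellIdx, hm]

theorem norm_le_of_forall_abs_le {c : ℝ} (hc : 0 ≤ c) (x : EuclideanSpace ℝ (Fin d))
    (hx : ∀ m, |x m| ≤ c) : ‖x‖ ≤ Real.sqrt d * c := by
  rw [EuclideanSpace.norm_eq, ← Real.sqrt_sq hc, ← Real.sqrt_mul (by positivity)]
  refine Real.sqrt_le_sqrt ?_
  calc ∑ m, ‖x m‖ ^ 2 ≤ ∑ _m : Fin d, c ^ 2 := by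
        gcongr with m
        exact hx m
    _ = d * c ^ 2 := by simp

theorem dist_le_of_cellIdx_eq {h : ℝ} (hh : 0 < h) {x y : EuclideanSpace ℝ (Fin d)}
    (hxy : cellIdx h x = cellIdx h y) : dist x y ≤ Real.sqrt d * h := by
  rw [dist_eq_norm]
  refine norm_le_of_forall_abs_le hh.le _ fun m => ?_
  have h1 := (cellIdx_eq_iff hh x _).1 rfl m
  have h2 := (cellIdx_eq_iff hh y _).1 rfl m
  rw [hxy] at h1
  simp only [mem_Ico] at h1 h2
  rw [PiLp.sub_apply, abs_le]
  constructor <;> linarith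

theorem cellIdx_smul_latPt {h : ℝ} (hh : 0 < h) (l : Fin d → ℤ) : cellIdx h (h • latPt l) = l := by
  rw [cellIdx_eq_iff hh]
  intro m
  simp only [latPt, PiLp.smul_apply, smul_eq_mul, mem_Ico]
  constructor <;> nlinarith

theorem uBar_eq_indicator_cellIdx {T : ℕ} (hT : 1 ≤ T) {X : Set (Node d k)}
    {Ω : Set (EuclideanSpace ℝ (Fin d))} {ε : ℝ} (hε : 0 < ε) (u : scaledNodes T X Ω ε → ℝ)
    (x : EuclideanSpace ℝ (Fin d)) :
    uBar u x = (innerCells T Ω ε).indicator (cellAvg T X (nodeVal u)) (cellIdx (ε * T) x) := by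
  classical
  unfold uBar
  rw [finsum_eq_single _ (cellIdx (ε * T) x)]
  · by_cases h : cellIdx (ε * T) x ∈ innerCells T Ω ε
    · rw [finsum_eq_if, if_pos h, indicator_of_mem h,
        indicator_of_mem ((mem_smul_cube_iff hε hT _ _).2 rfl)]
    · rw [finsum_eq_if, if_neg h, indicator_of_notMem h]
  · intro l hl
    rw [indicator_of_notMem fun hx => hl ((mem_smul_cube_iff hε hT _ _).1 hx).symm]
    simp

/-- A cell whose points are at distance at least `3 √d` cell sizes from the complement of `Ω` lies
in `Ω` and far from the boundary. -/
theorem mem_innerCells_inter_farCells {T : ℕ} (hT : 1 ≤ T) {Ω : Set (EuclideanSpace ℝ (Fin d))}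
    (hΩ : IsOpen Ω) {ε ρ : ℝ} (hε : 0 < ε) (hρ : 3 * (Real.sqrt d * (ε * T)) < ρ)
    {x : EuclideanSpace ℝ (Fin d)} (hx : Metric.ball x ρ ⊆ Ω) :
    cellIdx (ε * T) x ∈ innerCells T Ω ε ∩ farCells T Ω ε := by
  have hT' : (0 : ℝ) < T := by exact_mod_cast hT
  have hh : 0 < ε * T := by positivity
  have hs : 0 ≤ Real.sqrt d * (ε * T) := by positivity
  constructor
  · intro y hy
    refine hx ?_
    rw [Metric.mem_ball]
    exact (dist_le_of_cellIdx_eq hh ((mem_smul_cube_iff hε hT _ _).1 hy)).trans_lt (by linarith)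
  · set c := (ε * T) • latPt (cellIdx (ε * T) x) with hc
    have hcx : dist c x ≤ Real.sqrt d * (ε * T) :=
      dist_le_of_cellIdx_eq hh (cellIdx_smul_latPt hh _)
    have hle : ENNReal.ofReal (ρ - Real.sqrt d * (ε * T)) ≤ Metric.infEDist c (frontier Ω) := by
      refine Metric.le_infEDist.2 fun y hy => ?_
      rw [edist_dist]
      refine ENNReal.ofReal_le_ofReal ?_
      have hyΩ : y ∉ Ω := fun h => by
        rw [hΩ.frontier_eq] at hy
        exact hy.2 h
      have : ρ ≤ dist y x := by
        by_contra! hlt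
        exact hyΩ (hx hlt)
      have := dist_triangle y c x
      rw [dist_comm y c] at this
      linarith
    refine lt_of_lt_of_le ((ENNReal.ofReal_lt_ofReal_iff (by linarith)).2 ?_) hle
    nlinarith

end

section

/-! ### Bounds on cell averages and their differences -/

variable {d k : ℕ}

theorem IsAdmissible.add_smul_mem_iff {T : ℕ} {X : Set (Node d k)} (hX : IsAdmissible T X)
    (l : Fin d → ℤ) (i : Node d k) : (i.1 + (T : ℤ) • l, i.2) ∈ X ↔ i ∈ X := by
  let H : AddSubgroup (Fin d → ℤ) :=
    { carrier := {l | ∀ i : Node d k, (i.1 + (T : ℤ) • l, i.2) ∈ X ↔ i ∈ X}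
      zero_mem' := fun i => by simp
      add_mem' := fun {a b} ha hb i => by
        rw [smul_add, ← add_assoc]
        exact (hb (i.1 + (T : ℤ) • a, i.2)).trans (ha i)
      neg_mem' := fun {a} ha i => by
        have h := ha (i.1 + (T : ℤ) • -a, i.2)
        simpa using h.symm }
  suffices h : l ∈ H from h i
  rw [← Finset.univ_sum_single l]
  refine H.sum_mem fun m _ => ?_
  -- the periods form a subgroup, so it is enough that it contains the coordinate vectors
  have h1 : (Pi.single m 1 : Fin d → ℤ) ∈ H := fun i => by
    have h := hX.periodic m i
    have e : (T : ℤ) • (Pi.single m 1 : Fin d → ℤ) = Pi.single m (T : ℤ) := by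
      rw [← Pi.single_smul']; simp
    rw [e]
    exact h
  have e : (Pi.single m (l m) : Fin d → ℤ) = l m • Pi.single m 1 := by
    rw [← Pi.single_smul']; simp
  rw [e]
  exact H.zsmul_mem h1 _

/-- By periodicity every cell carries the same number of nodes. -/
theorem IsAdmissible.ncard_nodesIn_cube {T : ℕ} {X : Set (Node d k)} (hX : IsAdmissible T X)
    (l : Fin d → ℤ) :
    (nodesIn T X (cube T l)).ncard = (nodesIn T X (cube T (0 : Fin d → ℤ))).ncard := by
  have e : (fun i : Node d k => ((i.1 + (T : ℤ) • l, i.2) : Node d k)) ''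
      nodesIn T X (cube T (0 : Fin d → ℤ)) = nodesIn T X (cube T l) := by
    ext i
    constructor
    · rintro ⟨j, ⟨h1, h2, h3⟩, rfl⟩
      refine ⟨(hX.add_smul_mem_iff l j).2 h1, fun m => ?_, h3⟩
      have := h2 m
      simp only [latPt, Pi.zero_apply, Int.cast_zero, zero_mul, mem_Ico, zero_add, Pi.add_apply,
        Pi.smul_apply, smul_eq_mul, Int.cast_add, Int.cast_mul, Int.cast_natCast] at this ⊢
      constructor <;> linarith
    · rintro ⟨h1, h2, h3⟩
      refine ⟨(i.1 - (T : ℤ) • l, i.2), ⟨?_, fun m => ?_, h3⟩, by simp⟩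
      · rw [← hX.add_smul_mem_iff l]
        simpa using h1
      · have := h2 m
        simp only [latPt, Pi.zero_apply, Int.cast_zero, zero_mul, mem_Ico, zero_add, Pi.sub_apply,
          Pi.smul_apply, smul_eq_mul, Int.cast_sub, Int.cast_mul, Int.cast_natCast] at this ⊢
        constructor <;> linarith
  rw [← e]
  refine ncard_image_of_injective _ ?_
  rintro ⟨a, b⟩ ⟨a', b'⟩ h
  simpa using h

theorem IsAdmissible.ncard_nodesIn_cube_pos {T : ℕ} {X : Set (Node d k)} (hX : IsAdmissible T X) :
    0 < (nodesIn T X (cube T (0 : Fin d → ℤ))).ncard := by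
  obtain ⟨i, hi⟩ := hX.nonempty
  have hT : (0 : ℤ) < T := by exact_mod_cast hX.period_pos
  rw [← hX.ncard_nodesIn_cube fun m => i.1 m / T, ncard_pos (finite_nodesIn_cube T X _)]
  refine ⟨i, hi, fun m => ?_, fun n => ?_⟩
  · have h1 := Int.ediv_mul_le (i.1 m) hT.ne'
    have h2 := Int.lt_ediv_add_one_mul_self (i.1 m) hT
    rw [add_mul, one_mul] at h2
    simp only [latPt, mem_Ico]
    exact ⟨by exact_mod_cast h1, by exact_mod_cast h2⟩
  · obtain ⟨h1, h2⟩ := hX.bounded i hi n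
    simp only [latPt, mem_Ico, Pi.zero_apply, Int.cast_zero, zero_mul, zero_add]
    exact ⟨by exact_mod_cast h1, by exact_mod_cast (by omega : i.2 n < T)⟩

/-- Jensen's inequality for an average over a finite set. -/
theorem sq_inv_card_mul_sum_le {ι : Type*} (s : Finset ι) (f : ι → ℝ) :
    ((s.card : ℝ)⁻¹ * ∑ i ∈ s, f i) ^ 2 ≤ ∑ i ∈ s, f i ^ 2 := by
  rcases s.eq_empty_or_nonempty with rfl | hs
  · simp
  have hc : (1 : ℝ) ≤ s.card := by exact_mod_cast hs.card_pos
  have hnn : 0 ≤ ∑ i ∈ s, f i ^ 2 := Finset.sum_nonneg fun _ _ => sq_nonneg _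
  rw [mul_pow, inv_pow, inv_mul_le_iff₀ (by positivity)]
  refine sq_sum_le_card_mul_sum_sq.trans ?_
  gcongr
  nlinarith

theorem IsAdmissible.card_toFinset {T : ℕ} {X : Set (Node d k)} (hX : IsAdmissible T X)
    (l : Fin d → ℤ) : (finite_nodesIn_cube T X l).toFinset.card =
      (nodesIn T X (cube T (0 : Fin d → ℤ))).ncard := by
  rw [← hX.ncard_nodesIn_cube l, ncard_eq_toFinset_card _ (finite_nodesIn_cube T X l)]

theorem IsAdmissible.cellAvg_sq_le {T : ℕ} {X : Set (Node d k)} (hX : IsAdmissible T X)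
    (v : Node d k → ℝ) (l : Fin d → ℤ) :
    cellAvg T X v l ^ 2 ≤ ∑ i ∈ (finite_nodesIn_cube T X l).toFinset, |v i| ^ 2 := by
  simp only [sq_abs]
  rw [cellAvg, ← hX.card_toFinset l]
  exact sq_inv_card_mul_sum_le _ _

/-- The difference of two cell averages is the average of the differences over all pairs of nodes,
one from each cell, so Jensen's inequality applies. -/
theorem IsAdmissible.cellAvg_sub_sq_le {T : ℕ} {X : Set (Node d k)} (hX : IsAdmissible T X)
    (v : Node d k → ℝ) (l l' : Fin d → ℤ) :
    (cellAvg T X v l - cellAvg T X v l') ^ 2 ≤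
      ∑ i ∈ (finite_nodesIn_cube T X l).toFinset, ∑ j ∈ (finite_nodesIn_cube T X l').toFinset,
        |v i - v j| ^ 2 := by
  simp only [sq_abs]
  set s := (finite_nodesIn_cube T X l).toFinset with hs
  set t := (finite_nodesIn_cube T X l').toFinset with ht
  have hN : ((nodesIn T X (cube T (0 : Fin d → ℤ))).ncard : ℝ) ≠ 0 := by
    exact_mod_cast hX.ncard_nodesIn_cube_pos.ne'
  have e : cellAvg T X v l - cellAvg T X v l' =
      ((s ×ˢ t).card : ℝ)⁻¹ * ∑ p ∈ s ×ˢ t, (v p.1 - v p.2) := by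
    rw [Finset.sum_product]
    simp only [Finset.sum_sub_distrib, Finset.sum_const, nsmul_eq_mul, ← Finset.mul_sum,
      Finset.card_product, Nat.cast_mul, hs, ht, hX.card_toFinset, cellAvg]
    field_simp
  rw [e, ← Finset.sum_product' s t fun i j => (v i - v j) ^ 2]
  exact sq_inv_card_mul_sum_le _ _

theorem finset_sum_le_tsum_subtype {ι : Type*} (t : Finset ι) {s : Set ι} (h : ↑t ⊆ s)
    (f : ι → ℝ≥0∞) : ∑ i ∈ t, f i ≤ ∑' i : s, f i := by
  rw [← Finset.tsum_subtype]
  exact ENNReal.tsum_mono_subtype f h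

theorem ofReal_mul_sum {ι : Type*} (s : Finset ι) {c : ℝ} (hc : 0 ≤ c) {f : ι → ℝ}
    (hf : ∀ i, 0 ≤ f i) :
    ENNReal.ofReal (c * ∑ i ∈ s, f i) = ∑ i ∈ s, ENNReal.ofReal (c * f i) := by
  rw [Finset.mul_sum, ENNReal.ofReal_sum_of_nonneg fun i _ => mul_nonneg hc (hf i)]

variable {T : ℕ} {X : Set (Node d k)} {Ω : Set (EuclideanSpace ℝ (Fin d))} {ε : ℝ}

theorem IsAdmissible.tsum_cellAvg_le (hX : IsAdmissible T X) (hε : 0 < ε)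
    (u : scaledNodes T X Ω ε → ℝ) :
    ∑' l, ENNReal.ofReal (ε ^ d * cellAvg T X (nodeVal u) l ^ 2) ≤ massSum u := by
  refine ENNReal.tsum_le_tsum fun l => ?_
  refine le_trans (ENNReal.ofReal_le_ofReal
    (mul_le_mul_of_nonneg_left (hX.cellAvg_sq_le _ l) (by positivity))) ?_
  rw [ofReal_mul_sum _ (by positivity) fun i => by positivity]
  exact finset_sum_le_tsum_subtype _ (by simp)
    fun i => ENNReal.ofReal (ε ^ d * |nodeVal u i| ^ 2)

theorem nodesIn_mono {A B : Set (EuclideanSpace ℝ (Fin d))} (h : A ⊆ B) :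
    nodesIn T X A ⊆ nodesIn T X B :=
  fun _ hi => ⟨hi.1, h hi.2.1, hi.2.2⟩

theorem zero_mem_openBox {M : ℝ} (hM : 0 < M) : (0 : EuclideanSpace ℝ (Fin d)) ∈ openBox d M :=
  fun m => by simpa using hM

theorem IsAdmissible.tsum_nnPairs_le (hX : IsAdmissible T X) (hε : 0 < ε) {M : ℝ} (hM : 0 < M)
    (u : scaledNodes T X Ω ε → ℝ) :
    ∑' p : nnPairs T Ω ε, ENNReal.ofReal (ε ^ ((d : ℤ) - 2) *
      (cellAvg T X (nodeVal u) p.1.1 - cellAvg T X (nodeVal u) p.1.2) ^ 2) ≤ nnEnergy M u := by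
  refine ENNReal.tsum_le_tsum fun p => ?_
  obtain ⟨⟨l, l'⟩, hp⟩ := p
  have hsub : cube T l ∪ cube T l' ⊆ (cube T l ∪ cube T l') + openBox d M :=
    subset_add_left _ (zero_mem_openBox hM)
  refine le_trans (ENNReal.ofReal_le_ofReal
    (mul_le_mul_of_nonneg_left (hX.cellAvg_sub_sq_le _ l l') (by positivity))) ?_
  rw [ofReal_mul_sum _ (by positivity) fun i => by positivity]
  refine le_trans (Finset.sum_le_sum fun i _ => ?_)
    (finset_sum_le_tsum_subtype _ (s := pairNodes T X M l l') ?_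
      fun i => ∑' j : pairNodes T X M l l',
        ENNReal.ofReal (ε ^ ((d : ℤ) - 2) * |nodeVal u i - nodeVal u j| ^ 2))
  · rw [ofReal_mul_sum _ (by positivity) fun i => by positivity]
    refine finset_sum_le_tsum_subtype _ ?_
      fun j => ENNReal.ofReal (ε ^ ((d : ℤ) - 2) * |nodeVal u i - nodeVal u j| ^ 2)
    simpa [pairNodes] using nodesIn_mono (subset_union_right.trans hsub)
  · simpa [pairNodes] using nodesIn_mono (subset_union_left.trans hsub)

open Classical in
/-- The discrete gradient of the cell averages: in each coordinate direction the difference quotient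
between a cell and its successor, set to zero unless both cells are far from the boundary. -/
noncomputable def cellGrad (u : scaledNodes T X Ω ε → ℝ) (l : Fin d → ℤ) :
    EuclideanSpace ℝ (Fin d) :=
  WithLp.toLp 2 fun m =>
    if l ∈ farCells T Ω ε ∧ l + Pi.single m 1 ∈ farCells T Ω ε then
      (cellAvg T X (nodeVal u) (l + Pi.single m 1) - cellAvg T X (nodeVal u) l) / (ε * T)
    else 0

theorem dist_latPt_add_single (l : Fin d → ℤ) (m : Fin d) :
    dist (latPt l) (latPt (l + Pi.single m 1)) = 1 := by
  have e : latPt (l + Pi.single m 1) = latPt l + EuclideanSpace.single m (1 : ℝ) := by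
    ext m'
    by_cases hm : m' = m
    · subst hm; simp [latPt]
    · simp [latPt, hm]
  rw [e, dist_eq_norm]
  simp

theorem IsAdmissible.tsum_cellGrad_le (hX : IsAdmissible T X) (hε : 0 < ε) {M : ℝ} (hM : 0 < M)
    (u : scaledNodes T X Ω ε → ℝ) :
    ∑' l, ENNReal.ofReal ((ε * T) ^ d * ‖cellGrad u l‖ ^ 2) ≤ (T : ℝ≥0∞) ^ d * nnEnergy M u := by
  have hT : (1 : ℝ) ≤ T := by exact_mod_cast hX.period_pos
  set a := cellAvg T X (nodeVal u) with ha
  set good : Set ((Fin d → ℤ) × Fin d) :=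
    {q | q.1 ∈ farCells T Ω ε ∧ q.1 + Pi.single q.2 1 ∈ farCells T Ω ε} with hgood
  set F : (Fin d → ℤ) × Fin d → ℝ≥0∞ := fun q =>
    ENNReal.ofReal ((ε * T) ^ d * |cellGrad u q.1 q.2| ^ 2) with hF
  set W : nnPairs T Ω ε → ℝ≥0∞ := fun p =>
    ENNReal.ofReal (ε ^ ((d : ℤ) - 2) * (a p.1.1 - a p.1.2) ^ 2) with hW
  have e1 : ∑' l, ENNReal.ofReal ((ε * T) ^ d * ‖cellGrad u l‖ ^ 2) = ∑' q, F q := by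
    rw [ENNReal.tsum_prod']
    congr 1
    ext l
    rw [EuclideanSpace.norm_sq_eq, ofReal_mul_sum _ (by positivity) fun i => by positivity,
      tsum_fintype]
    simp [hF]
  have hsupp : Function.support F ⊆ good := by
    intro q hq
    by_contra hng
    refine hq ?_
    have : cellGrad u q.1 q.2 = 0 := by
      simp only [cellGrad]
      exact if_neg hng
    simp [hF, this]
  -- a cell and a direction determine an ordered pair of neighbours, so no energy is counted twice
  let ψ : good → nnPairs T Ω ε := fun q =>
    ⟨(q.1.1, q.1.1 + Pi.single q.1.2 1), q.2.1, q.2.2, dist_latPt_add_single _ _⟩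
  have hψ : Function.Injective ψ := by
    rintro ⟨⟨l, m⟩, h1⟩ ⟨⟨l', m'⟩, h2⟩ h
    have h' := congrArg Subtype.val h
    simp only [ψ, Prod.mk.injEq] at h'
    obtain ⟨rfl, h⟩ := h'
    have h' := congrFun (add_left_cancel h) m
    by_cases hm : m = m'
    · subst hm; rfl
    · simp [hm] at h'
  have hFW : ∀ q : good, F q ≤ (T : ℝ≥0∞) ^ d * W (ψ q) := by
    rintro ⟨⟨l, m⟩, hq⟩
    have e2 : cellGrad u l m = (a (l + Pi.single m 1) - a l) / (ε * T) := by
      simp only [cellGrad]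
      exact if_pos hq
    have e3 : (T : ℝ≥0∞) ^ d = ENNReal.ofReal ((T : ℝ) ^ d) := by
      rw [ENNReal.ofReal_pow (by positivity), ENNReal.ofReal_natCast]
    simp only [hF, hW, ψ, e2]
    rw [e3, ← ENNReal.ofReal_mul (by positivity)]
    refine ENNReal.ofReal_le_ofReal ?_
    rw [sq_abs, div_pow, mul_pow, mul_pow, zpow_sub₀ hε.ne', zpow_natCast]
    have e4 : (a (l + Pi.single m 1) - a l) ^ 2 = (a l - a (l + Pi.single m 1)) ^ 2 := by ring
    rw [e4]
    -- scaling the mesh from `ε` to `ε T` costs the factor `T ^ (d - 2) ≤ T ^ d`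
    have e5 : ε ^ d * (T : ℝ) ^ d * ((a l - a (l + Pi.single m 1)) ^ 2 / (ε ^ 2 * (T : ℝ) ^ 2)) =
        ((T : ℝ) ^ d * (ε ^ d / ε ^ (2 : ℤ) * (a l - a (l + Pi.single m 1)) ^ 2)) / (T : ℝ) ^ 2 := by
      rw [zpow_ofNat]
      field_simp
    rw [e5]
    exact div_le_self (by positivity) (one_le_pow₀ hT)
  rw [e1, ← tsum_subtype_eq_of_support_subset hsupp]
  calc ∑' q : good, F q ≤ ∑' q : good, (T : ℝ≥0∞) ^ d * W (ψ q) := ENNReal.tsum_le_tsum hFW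
    _ = (T : ℝ≥0∞) ^ d * ∑' q : good, W (ψ q) := ENNReal.tsum_mul_left
    _ ≤ (T : ℝ≥0∞) ^ d * ∑' p, W p := by
        gcongr
        exact ENNReal.tsum_comp_le_tsum_of_injective hψ W
    _ ≤ _ := by
        gcongr
        exact hX.tsum_nnPairs_le hε hM u

end

section

/-! ### Translation estimates from discrete gradients -/

variable {d : ℕ}

/-- A function that is constant along `[0, h)` up to a jump of length `h`, and whose jumps of length
`h` in direction `m` are `h` times a coordinate of `g`, changes over a length `q h + r` by at most
`h` times a sum of `q + 1` translates of `‖g‖`. -/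
theorem abs_sub_le_sum_of_step {f : EuclideanSpace ℝ (Fin d) → ℝ}
    {g : EuclideanSpace ℝ (Fin d) → EuclideanSpace ℝ (Fin d)} {U : Set (EuclideanSpace ℝ (Fin d))}
    {h : ℝ} (hh : 0 < h) (m : Fin d)
    (hstep : ∀ y ∈ U, f (y + EuclideanSpace.single m h) - f y = h * g y m)
    (hres : ∀ y, ∀ r, 0 ≤ r → r < h → f (y + EuclideanSpace.single m r) = f y ∨
      f (y + EuclideanSpace.single m r) = f (y + EuclideanSpace.single m h))
    (q : ℕ) {r : ℝ} (hr : 0 ≤ r) (hrh : r < h) {y : EuclideanSpace ℝ (Fin d)}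
    (hy : ∀ j : ℕ, j ≤ q → y + EuclideanSpace.single m (j * h) ∈ U) :
    |f (y + EuclideanSpace.single m (q * h + r)) - f y| ≤
      ∑ j ∈ Finset.range (q + 1), h * ‖g (y + EuclideanSpace.single m (j * h))‖ := by
  have hadd : ∀ s t : ℝ, y + EuclideanSpace.single m (s + t) =
      y + EuclideanSpace.single m s + EuclideanSpace.single m t := by
    intro s t
    rw [add_assoc]
    congr 1
    ext m'
    by_cases hm : m' = m
    · subst hm; simp
    · simp [hm]
  have hbound : ∀ j : ℕ, j ≤ q → |f (y + EuclideanSpace.single m (j * h) +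
      EuclideanSpace.single m h) - f (y + EuclideanSpace.single m (j * h))| ≤
      h * ‖g (y + EuclideanSpace.single m (j * h))‖ := by
    intro j hj
    rw [hstep _ (hy j hj), abs_mul, abs_of_pos hh]
    gcongr
    exact PiLp.norm_apply_le (g _) m
  have htel : f (y + EuclideanSpace.single m (q * h)) - f y =
      ∑ j ∈ Finset.range q, (f (y + EuclideanSpace.single m (j * h) +
        EuclideanSpace.single m h) - f (y + EuclideanSpace.single m (j * h))) := by
    have e := Finset.sum_range_sub (fun j : ℕ => f (y + EuclideanSpace.single m (j * h))) q
    have h0 : y + EuclideanSpace.single m (0 : ℝ) = y := by ext; simp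
    simp only [Nat.cast_zero, zero_mul, h0] at e
    rw [← e]
    refine Finset.sum_congr rfl fun j _ => ?_
    rw [← hadd]
    push_cast
    rw [add_mul, one_mul]
  have hlast : |f (y + EuclideanSpace.single m (q * h + r)) -
      f (y + EuclideanSpace.single m (q * h))| ≤
      h * ‖g (y + EuclideanSpace.single m (q * h))‖ := by
    rw [hadd]
    rcases hres (y + EuclideanSpace.single m (q * h)) r hr hrh with e | e
    · rw [e]; simp only [sub_self, abs_zero]; positivity
    · rw [e]; exact hbound q le_rfl
  rw [Finset.sum_range_succ]
  calc |f (y + EuclideanSpace.single m (q * h + r)) - f y|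
      ≤ |f (y + EuclideanSpace.single m (q * h)) - f y| +
        |f (y + EuclideanSpace.single m (q * h + r)) - f (y + EuclideanSpace.single m (q * h))| := by
        linarith [abs_sub_le (f (y + EuclideanSpace.single m (q * h + r)))
          (f (y + EuclideanSpace.single m (q * h))) (f y)]
    _ ≤ _ := by
        refine add_le_add ?_ hlast
        rw [htel]
        refine (Finset.abs_sum_le_sum_abs _ _).trans (Finset.sum_le_sum fun j hj => ?_)
        exact hbound j (Finset.mem_range.1 hj).le

/-- The pointwise majorant of a translation by `t` in one direction, with its `L²` norm: it is a sum
of `⌊t / h⌋ + 1` translates of `h ‖g‖`. -/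
theorem exists_bound_translate_single {f : EuclideanSpace ℝ (Fin d) → ℝ}
    {g : EuclideanSpace ℝ (Fin d) → EuclideanSpace ℝ (Fin d)} (hg : Measurable g)
    {U : Set (EuclideanSpace ℝ (Fin d))} {h : ℝ} (hh : 0 < h) (m : Fin d)
    (hstep : ∀ y ∈ U, f (y + EuclideanSpace.single m h) - f y = h * g y m)
    (hres : ∀ y, ∀ r, 0 ≤ r → r < h → f (y + EuclideanSpace.single m r) = f y ∨
      f (y + EuclideanSpace.single m r) = f (y + EuclideanSpace.single m h))
    {t : ℝ} (ht : 0 ≤ t) :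
    ∃ b : EuclideanSpace ℝ (Fin d) → ℝ, Measurable b ∧
      eLpNorm b 2 volume ≤ ENNReal.ofReal (t + h) * eLpNorm g 2 volume ∧
      ∀ y, (∀ s ∈ Icc 0 t, y + EuclideanSpace.single m s ∈ U) →
        |f (y + EuclideanSpace.single m t) - f y| ≤ b y := by
  set q := ⌊t / h⌋₊ with hq
  have hqt : q * h ≤ t := (le_div_iff₀ hh).1 (Nat.floor_le (by positivity))
  have htq : t < q * h + h := by
    have := (div_lt_iff₀ hh).1 (Nat.lt_floor_add_one (t / h))
    rwa [add_mul, one_mul] at this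
  set b : ℕ → EuclideanSpace ℝ (Fin d) → ℝ := fun j y =>
    h * ‖g (y + EuclideanSpace.single m (j * h))‖ with hb
  have hbm : ∀ j, Measurable (b j) := fun j => by simp only [hb]; fun_prop
  refine ⟨fun y => ∑ j ∈ Finset.range (q + 1), b j y,
    Finset.measurable_fun_sum _ fun j _ => hbm j, ?_, fun y hy => ?_⟩
  · have e : (fun y => ∑ j ∈ Finset.range (q + 1), b j y) = ∑ j ∈ Finset.range (q + 1), b j := by
      ext y; simp
    rw [e]
    refine (eLpNorm_sum_le (fun j _ => (hbm j).aestronglyMeasurable) (by norm_num)).trans ?_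
    have hj : ∀ j, eLpNorm (b j) 2 volume = ENNReal.ofReal h * eLpNorm g 2 volume := by
      intro j
      have h1 := eLpNorm_const_smul h
        (fun y => ‖g (y + EuclideanSpace.single m (j * h))‖) 2 volume
      rw [eLpNorm_norm (fun y => g (y + EuclideanSpace.single m (j * h))),
        eLpNorm_comp_add_right 2 hg.aestronglyMeasurable, Real.enorm_eq_ofReal hh.le] at h1
      exact h1
    simp only [hj, Finset.sum_const, Finset.card_range, nsmul_eq_mul]
    rw [← mul_assoc, ← ENNReal.ofReal_natCast, ← ENNReal.ofReal_mul (by positivity)]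
    gcongr
    push_cast
    linarith
  · have h1 := abs_sub_le_sum_of_step hh m hstep hres q (r := t - q * h) (y := y) (by linarith)
      (by linarith) fun j hj => hy _ ⟨by positivity, le_trans (by gcongr) hqt⟩
    simpa using h1

/-- Translations by vectors with coordinates in `[0, H]` cost at most `d (H + h) ‖g‖` in `L²(K)`:
the coordinates are moved one at a time. -/
theorem eLpNorm_translate_sub_le {f : EuclideanSpace ℝ (Fin d) → ℝ}
    {g : EuclideanSpace ℝ (Fin d) → EuclideanSpace ℝ (Fin d)} (hg : Measurable g)
    {U K : Set (EuclideanSpace ℝ (Fin d))} (hK : MeasurableSet K) {h H : ℝ} (hh : 0 < h)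
    (hKU : ∀ x ∈ K, Metric.closedBall x (d * H) ⊆ U)
    (hstep : ∀ m, ∀ y ∈ U, f (y + EuclideanSpace.single m h) - f y = h * g y m)
    (hres : ∀ m y, ∀ r, 0 ≤ r → r < h → f (y + EuclideanSpace.single m r) = f y ∨
      f (y + EuclideanSpace.single m r) = f (y + EuclideanSpace.single m h))
    (z : EuclideanSpace ℝ (Fin d)) (hz : ∀ m, z m ∈ Icc 0 H) :
    eLpNorm (fun x => f (x + z) - f x) 2 (volume.restrict K) ≤
      d * (ENNReal.ofReal (H + h) * eLpNorm g 2 volume) := by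
  classical
  have key : ∀ s : Finset (Fin d), ∃ b : EuclideanSpace ℝ (Fin d) → ℝ, Measurable b ∧
      eLpNorm b 2 volume ≤ s.card * (ENNReal.ofReal (H + h) * eLpNorm g 2 volume) ∧
      ∀ x ∈ K, |f (x + ∑ m ∈ s, EuclideanSpace.single m (z m)) - f x| ≤ b x := by
    intro s
    induction s using Finset.induction_on with
    | empty => exact ⟨0, measurable_zero, by simp, by simp⟩
    | insert m s hm ih =>
      obtain ⟨b, hbm, hbn, hb⟩ := ih
      obtain ⟨c, hcm, hcn, hc⟩ :=
        exists_bound_translate_single hg hh m (hstep m) (hres m) (hz m).1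
      set w := ∑ m ∈ s, EuclideanSpace.single m (z m) with hw
      have hcw : Measurable fun x => c (x + w) := by fun_prop
      refine ⟨fun x => b x + c (x + w), hbm.add hcw, ?_, fun x hx => ?_⟩
      · refine (eLpNorm_add_le hbm.aestronglyMeasurable hcw.aestronglyMeasurable
          (by norm_num)).trans ?_
        rw [eLpNorm_comp_add_right 2 hcm.aestronglyMeasurable, Finset.card_insert_of_notMem hm]
        push_cast
        rw [add_mul, one_mul]
        refine add_le_add hbn (hcn.trans ?_)
        gcongr
        exact (hz m).2
      · have hw_norm : ‖w‖ ≤ s.card * H := by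
          refine (norm_sum_le _ _).trans ?_
          rw [← nsmul_eq_mul]
          refine Finset.sum_le_card_nsmul _ _ _ fun m' _ => ?_
          rw [PiLp.norm_single, Real.norm_of_nonneg (hz m').1]
          exact (hz m').2
        have hcard : (s.card : ℝ) + 1 ≤ d := by
          have h1 := Finset.card_le_univ (insert m s)
          rw [Finset.card_insert_of_notMem hm, Fintype.card_fin] at h1
          exact_mod_cast h1
        have hH : 0 ≤ H := (hz m).1.trans (hz m).2
        have h1 := hc (x + w) fun r hr => hKU x hx (by
          rw [Metric.mem_closedBall, dist_eq_norm, add_assoc, add_sub_cancel_left]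
          refine (norm_add_le _ _).trans ?_
          rw [PiLp.norm_single, Real.norm_of_nonneg hr.1]
          nlinarith [hr.2.trans (hz m).2])
        rw [Finset.sum_insert hm, add_comm (EuclideanSpace.single m (z m)), ← add_assoc]
        have h2 := abs_sub_le (f (x + w + EuclideanSpace.single m (z m))) (f (x + w)) (f x)
        linarith [hb x hx]
  obtain ⟨b, hbm, hbn, hb⟩ := key Finset.univ
  have e : ∑ m, EuclideanSpace.single m (z m) = z := by
    ext m'
    simp [WithLp.ofLp_sum, Finset.sum_apply, Pi.single_apply]
  rw [e] at hb
  rw [Finset.card_univ, Fintype.card_fin] at hbn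
  refine le_trans (eLpNorm_mono_ae_real ?_)
    ((eLpNorm_mono_measure b Measure.restrict_le_self).trans hbn)
  exact ae_restrict_of_forall_mem hK hb

end

section

/-! ### Passing to the weak gradient -/

/-- Difference quotients of a test function converge in `L²`. -/
theorem tendsto_eLpNorm_diffQuot {E : Type*} [NormedAddCommGroup E] [InnerProductSpace ℝ E]
    [FiniteDimensional ℝ E] [MeasurableSpace E] [BorelSpace E] {φ : E → ℝ} (hφ : ContDiff ℝ ∞ φ)
    (hφc : HasCompactSupport φ) (e : E) {h : ℕ → ℝ} (hh : ∀ n, 0 < h n)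
    (hh0 : Tendsto h atTop (𝓝 0)) :
    Tendsto (fun n => eLpNorm (fun x => (h n)⁻¹ * (φ (x - h n • e) - φ x) + fderiv ℝ φ x e) 2
      volume) atTop (𝓝 0) := by
  have hφ1 : ContDiff ℝ 1 φ := hφ.of_le (by exact_mod_cast le_top)
  obtain ⟨C, hC⟩ := hφ1.lipschitzWith_of_hasCompactSupport hφc (by norm_num)
  have hdiff : Differentiable ℝ φ := hφ1.differentiable (by norm_num)
  have hcont : Continuous fun x => fderiv ℝ φ x e :=
    (hφ1.continuous_fderiv (by norm_num)).clm_apply continuous_const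
  set S := Metric.cthickening ‖e‖ (tsupport φ) with hS
  have hSc : IsCompact S := hφc.cthickening
  have hev : ∀ᶠ n in atTop, h n < 1 := hh0.eventually_lt_const one_pos
  refine tendsto_eLpNorm_two_zero ?_
  rw [show (0 : ℝ≥0∞) = ∫⁻ _ : E, 0 by simp]
  have hzero : ∀ x ∉ S, φ x = 0 ∧ fderiv ℝ φ x e = 0 := by
    intro x hx
    have hx' : x ∉ tsupport φ := fun h' => hx (Metric.self_subset_cthickening _ h')
    refine ⟨image_eq_zero_of_notMem_tsupport hx', ?_⟩
    rw [image_eq_zero_of_notMem_tsupport fun h' => hx' (tsupport_fderiv_subset ℝ h')]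
    rfl
  refine tendsto_lintegral_filter_of_dominated_convergence
    (S.indicator fun _ => ENNReal.ofReal (2 * (C * ‖e‖)) ^ 2)
    (Eventually.of_forall fun n => ?_) ?_ ?_ (Eventually.of_forall fun x => ?_)
  · have : Measurable fun x => (h n)⁻¹ * (φ (x - h n • e) - φ x) + fderiv ℝ φ x e := by
      have h1 := hφ1.continuous
      exact Continuous.measurable (by fun_prop)
    exact this.enorm.pow_const 2
  · filter_upwards [hev] with n hn
    refine Eventually.of_forall fun x => ?_
    by_cases hx : x ∈ S
    · rw [indicator_of_mem hx, ← ofReal_norm]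
      gcongr
      have h1 : ‖(h n)⁻¹ * (φ (x - h n • e) - φ x)‖ ≤ C * ‖e‖ := by
        rw [norm_mul, norm_inv, Real.norm_of_nonneg (hh n).le, inv_mul_le_iff₀ (hh n)]
        refine (hC.norm_sub_le _ _).trans (le_of_eq ?_)
        rw [sub_sub_cancel_left, norm_neg, norm_smul, Real.norm_of_nonneg (hh n).le]
        ring
      have h2 : ‖fderiv ℝ φ x e‖ ≤ C * ‖e‖ :=
        (ContinuousLinearMap.le_opNorm _ _).trans (by
          gcongr
          exact norm_fderiv_le_of_lipschitz ℝ hC)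
      linarith [norm_add_le ((h n)⁻¹ * (φ (x - h n • e) - φ x)) (fderiv ℝ φ x e)]
    · have hx' : x - h n • e ∉ tsupport φ := by
        intro h'
        refine hx (Metric.mem_cthickening_of_dist_le x _ _ _ h' ?_)
        rw [dist_eq_norm, sub_sub_cancel, norm_smul, Real.norm_of_nonneg (hh n).le]
        nlinarith [norm_nonneg e]
      simp [hzero x hx, image_eq_zero_of_notMem_tsupport hx', hx]
  · rw [lintegral_indicator hSc.measurableSet, lintegral_const]
    refine ENNReal.mul_ne_top (ENNReal.pow_ne_top ENNReal.ofReal_ne_top) ?_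
    simpa using hSc.measure_lt_top.ne
  · have h1 := ((hdiff x).hasFDerivAt.hasLineDerivAt (-e)).tendsto_slope_zero_right
    have h2 : Tendsto h atTop (𝓝[>] 0) :=
      tendsto_nhdsWithin_iff.2 ⟨hh0, Eventually.of_forall hh⟩
    have h3 := ((h1.comp h2).add_const (fderiv ℝ φ x e)).enorm
    replace h3 := ((ENNReal.continuous_pow 2).tendsto _).comp h3
    simpa [Function.comp_def, sub_eq_add_neg] using h3

variable {d : ℕ}

theorem single_eq_smul_single_one (m : Fin d) (t : ℝ) :
    EuclideanSpace.single m t = t • EuclideanSpace.single m (1 : ℝ) := by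
  ext m'
  by_cases hm : m' = m
  · subst hm; simp
  · simp [hm]

/-- If the difference quotients of `f n` over the step `h n → 0` agree with `g n` on the support of
each test function for large `n`, then the weak limit of `g n` is the weak gradient of the weak
limit of `f n`: the difference quotient is moved to the test function. -/
theorem integral_mul_fderiv_eq_of_weak {f : ℕ → EuclideanSpace ℝ (Fin d) → ℝ}
    {g : ℕ → EuclideanSpace ℝ (Fin d) → EuclideanSpace ℝ (Fin d)}
    {u : EuclideanSpace ℝ (Fin d) → ℝ} {G : EuclideanSpace ℝ (Fin d) → EuclideanSpace ℝ (Fin d)}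
    (hf : ∀ n, MemLp (f n) 2 volume) {B : ℝ≥0} (hB : ∀ n, eLpNorm (f n) 2 volume ≤ B)
    (hfu : ∀ w : EuclideanSpace ℝ (Fin d) → ℝ, MemLp w 2 volume →
      Tendsto (fun n => ∫ x, f n x * w x) atTop (𝓝 (∫ x, u x * w x)))
    (hgG : ∀ w : EuclideanSpace ℝ (Fin d) → ℝ, MemLp w 2 volume → ∀ m,
      Tendsto (fun n => ∫ x, g n x m * w x) atTop (𝓝 (∫ x, G x m * w x)))
    {h : ℕ → ℝ} (hh : ∀ n, 0 < h n) (hh0 : Tendsto h atTop (𝓝 0))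
    {φ : EuclideanSpace ℝ (Fin d) → ℝ} (hφ : ContDiff ℝ ∞ φ) (hφc : HasCompactSupport φ)
    (m : Fin d) (hstep : ∀ᶠ n in atTop, ∀ x ∈ tsupport φ,
      f n (x + EuclideanSpace.single m (h n)) - f n x = h n * g n x m) :
    ∫ x, u x * fderiv ℝ φ x (EuclideanSpace.single m 1) = -∫ x, G x m * φ x := by
  have hφ1 : ContDiff ℝ 1 φ := hφ.of_le (by exact_mod_cast le_top)
  have hφL : MemLp φ 2 volume := hφ1.continuous.memLp_of_hasCompactSupport hφc
  set e : EuclideanSpace ℝ (Fin d) := EuclideanSpace.single m 1 with he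
  set dφ : EuclideanSpace ℝ (Fin d) → ℝ := fun x => fderiv ℝ φ x e with hdφ
  have hdφL : MemLp dφ 2 volume := by
    refine Continuous.memLp_of_hasCompactSupport
      ((hφ1.continuous_fderiv (by norm_num)).clm_apply continuous_const) ?_
    exact hφc.fderiv_apply (𝕜 := ℝ) e
  set ψ : ℕ → EuclideanSpace ℝ (Fin d) → ℝ := fun n x => (h n)⁻¹ * (φ (x - h n • e) - φ x) with hψ
  have hshift : ∀ n, MemLp (fun x => φ (x - h n • e)) 2 volume := fun n => by
    simpa only [sub_eq_add_neg] using memLp_comp_add_right hφL (-(h n • e))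
  have hψL : ∀ n, MemLp (ψ n) 2 volume := fun n => ((hshift n).sub hφL).const_mul _
  -- move the difference quotient onto the test function, by translation invariance
  have hparts : ∀ᶠ n in atTop, ∫ x, g n x m * φ x = ∫ x, f n x * ψ n x := by
    filter_upwards [hstep] with n hn
    have i1 : Integrable (fun x => f n x * φ (x - h n • e)) volume := (hf n).integrable_mul (hshift n)
    have i2 : Integrable (fun x => f n x * φ x) volume := (hf n).integrable_mul hφL
    have i3 : Integrable (fun x => f n (x + h n • e) * φ x) volume :=
      (memLp_comp_add_right (hf n) (h n • e)).integrable_mul hφL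
    have e1 : ∀ x, g n x m * φ x = (h n)⁻¹ * (f n (x + h n • e) * φ x - f n x * φ x) := by
      intro x
      by_cases hx : x ∈ tsupport φ
      · rw [← sub_mul, ← single_eq_smul_single_one, hn x hx]
        field_simp [(hh n).ne']
      · simp [image_eq_zero_of_notMem_tsupport hx]
    have e2 : ∀ x, f n x * ψ n x = (h n)⁻¹ * (f n x * φ (x - h n • e) - f n x * φ x) := by
      intro x; simp only [hψ]; ring
    simp only [e1, e2, integral_const_mul]
    rw [integral_sub i3 i2, integral_sub i1 i2]
    congr 2
    rw [← integral_add_right_eq_self (fun x => f n x * φ (x - h n • e)) (h n • e)]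
    simp
  have hsum : Tendsto (fun n => ∫ x, f n x * (ψ n x + dφ x)) atTop (𝓝 0) := by
    have hq := tendsto_eLpNorm_diffQuot hφ hφc e hh hh0
    have hq' : Tendsto (fun n => (B : ℝ≥0∞) * eLpNorm (fun x => ψ n x + dφ x) 2 volume) atTop
        (𝓝 0) := by
      simpa using ENNReal.Tendsto.const_mul hq (Or.inr ENNReal.coe_ne_top)
    rw [tendsto_zero_iff_enorm_tendsto_zero]
    refine tendsto_of_tendsto_of_tendsto_of_le_of_le tendsto_const_nhds hq' (fun n => bot_le)
      fun n => ?_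
    refine (enorm_integral_le_lintegral_enorm _).trans ?_
    rw [← eLpNorm_one_eq_lintegral_enorm]
    refine (eLpNorm_smul_le_mul_eLpNorm (p := 2) (q := 2) (r := 1)
      ((hψL n).add hdφL).1 (hf n).1).trans ?_
    gcongr
    · exact hB n
    · exact le_rfl
  have hlim : Tendsto (fun n => ∫ x, g n x m * φ x) atTop (𝓝 (0 - ∫ x, u x * dφ x)) := by
    refine (hsum.sub (hfu dφ hdφL)).congr' ?_
    filter_upwards [hparts] with n hn
    have i1 : Integrable (fun x => f n x * (ψ n x + dφ x)) volume :=
      (hf n).integrable_mul ((hψL n).add hdφL)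
    have i2 : Integrable (fun x => f n x * dφ x) volume := (hf n).integrable_mul hdφL
    rw [hn, ← integral_sub i1 i2]
    simp only [mul_add, add_sub_cancel_right]
  rw [tendsto_nhds_unique (hgG φ hφL m) hlim]
  ring

end

section

/-! ### Compactness of the piecewise constant functions -/

variable {d k : ℕ} {T : ℕ} {X : Set (Node d k)} {Ω : Set (EuclideanSpace ℝ (Fin d))}

theorem measurable_uBar (hT : 1 ≤ T) {ε : ℝ} (hε : 0 < ε) (u : scaledNodes T X Ω ε → ℝ) :
    Measurable (uBar u) := by
  rw [funext (uBar_eq_indicator_cellIdx hT hε u)]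
  exact (measurable_of_countable
    ((innerCells T Ω ε).indicator (cellAvg T X (nodeVal u)))).comp (measurable_cellIdx _)

theorem measurable_cellGrad_comp {ε : ℝ} (u : scaledNodes T X Ω ε → ℝ) (h : ℝ) :
    Measurable fun x : EuclideanSpace ℝ (Fin d) => cellGrad u (cellIdx h x) :=
  (measurable_of_countable (cellGrad u)).comp (measurable_cellIdx h)

theorem IsAdmissible.eLpNorm_uBar_le (hX : IsAdmissible T X) {ε : ℝ} (hε : 0 < ε)
    (u : scaledNodes T X Ω ε → ℝ) {C : ℝ≥0} (hu : massSum u ≤ C) :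
    eLpNorm (uBar u) 2 volume ≤ (NNReal.sqrt (T ^ d * C) : ℝ≥0) := by
  have hT : (0 : ℝ) < T := by exact_mod_cast hX.period_pos
  rw [funext (uBar_eq_indicator_cellIdx hX.period_pos hε u)]
  refine eLpNorm_comp_cellIdx_le (by positivity) _ ?_
  rw [← ENNReal.coe_pow, NNReal.sq_sqrt]
  calc ∑' l, ENNReal.ofReal ((ε * T) ^ d *
        ‖(innerCells T Ω ε).indicator (cellAvg T X (nodeVal u)) l‖ ^ 2)
      ≤ ∑' l, (T : ℝ≥0∞) ^ d * ENNReal.ofReal (ε ^ d * cellAvg T X (nodeVal u) l ^ 2) := by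
        refine ENNReal.tsum_le_tsum fun l => ?_
        rw [← ENNReal.ofReal_natCast, ← ENNReal.ofReal_pow hT.le,
          ← ENNReal.ofReal_mul (by positivity)]
        refine ENNReal.ofReal_le_ofReal ?_
        rw [mul_pow, mul_comm (ε ^ d), mul_assoc, ← sq_abs (cellAvg T X (nodeVal u) l)]
        gcongr
        exact norm_indicator_le_norm_self _ _
    _ ≤ (T : ℝ≥0∞) ^ d * C := by
        rw [ENNReal.tsum_mul_left]
        gcongr
        exact (hX.tsum_cellAvg_le hε u).trans hu
    _ = _ := by push_cast; rfl

theorem IsAdmissible.eLpNorm_cellGrad_le (hX : IsAdmissible T X) {ε : ℝ} (hε : 0 < ε) {M : ℝ}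
    (hM : 0 < M) (u : scaledNodes T X Ω ε → ℝ) {C : ℝ≥0} (hu : nnEnergy M u ≤ C) :
    eLpNorm (fun x => cellGrad u (cellIdx (ε * T) x)) 2 volume ≤
      (NNReal.sqrt (T ^ d * C) : ℝ≥0) := by
  have hT : (0 : ℝ) < T := by exact_mod_cast hX.period_pos
  refine eLpNorm_comp_cellIdx_le (by positivity) _ ?_
  rw [← ENNReal.coe_pow, NNReal.sq_sqrt]
  refine (hX.tsum_cellGrad_le hε hM u).trans ?_
  push_cast
  gcongr

/-- Well inside `Ω` the jump of `ū_ε` between neighbouring cells is the discrete gradient. -/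
theorem uBar_add_single_sub (hT : 1 ≤ T) (hΩ : IsOpen Ω) {ε ρ : ℝ} (hε : 0 < ε)
    (hρ : 3 * (Real.sqrt d * (ε * T)) + ε * T < ρ) (u : scaledNodes T X Ω ε → ℝ)
    {y : EuclideanSpace ℝ (Fin d)} (hy : Metric.ball y ρ ⊆ Ω) (m : Fin d) :
    uBar u (y + EuclideanSpace.single m (ε * T)) - uBar u y =
      ε * T * cellGrad u (cellIdx (ε * T) y) m := by
  have hT' : (0 : ℝ) < T := by exact_mod_cast hT
  have hh : 0 < ε * T := by positivity
  have h1 := mem_innerCells_inter_farCells hT hΩ hε (by linarith) hy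
  have h2 : cellIdx (ε * T) (y + EuclideanSpace.single m (ε * T)) ∈
      innerCells T Ω ε ∩ farCells T Ω ε := by
    refine mem_innerCells_inter_farCells hT hΩ hε (ρ := ρ - ε * T) (by linarith)
      (subset_trans (Metric.ball_subset_ball' ?_) hy)
    rw [dist_eq_norm, add_sub_cancel_left, PiLp.norm_single, Real.norm_of_nonneg hh.le]
    linarith
  rw [uBar_eq_indicator_cellIdx hT hε, uBar_eq_indicator_cellIdx hT hε, indicator_of_mem h1.1,
    indicator_of_mem h2.1]
  rw [cellIdx_add_single hh] at h2 ⊢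
  have e : cellGrad u (cellIdx (ε * T) y) m =
      (cellAvg T X (nodeVal u) (cellIdx (ε * T) y + Pi.single m 1) -
        cellAvg T X (nodeVal u) (cellIdx (ε * T) y)) / (ε * T) := by
    simp only [cellGrad]
    exact if_pos ⟨h1.2, h2.2⟩
  rw [e, mul_div_cancel₀ _ hh.ne']

theorem uBar_add_single_of_lt (hT : 1 ≤ T) {ε r : ℝ} (hε : 0 < ε) (hr : 0 ≤ r) (hrh : r < ε * T)
    (u : scaledNodes T X Ω ε → ℝ) (y : EuclideanSpace ℝ (Fin d)) (m : Fin d) :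
    uBar u (y + EuclideanSpace.single m r) = uBar u y ∨
      uBar u (y + EuclideanSpace.single m r) =
        uBar u (y + EuclideanSpace.single m (ε * T)) := by
  simp only [uBar_eq_indicator_cellIdx hT hε]
  rw [cellIdx_add_single (hr.trans_lt hrh)]
  exact (cellIdx_add_single_of_lt hr hrh y m).imp (congrArg _) (congrArg _)

/-- The jump formula holds near a compact subset of `Ω` for all small `ε`. -/
theorem exists_eventually_uBar_add_single_sub (hT : 1 ≤ T) (hΩ : IsOpen Ω)
    (u : ∀ ε : ℝ, scaledNodes T X Ω ε → ℝ) {ε : ℕ → ℝ} (hε : ∀ n, 0 < ε n)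
    (hε0 : Tendsto ε atTop (𝓝 0)) {K : Set (EuclideanSpace ℝ (Fin d))} (hK : IsCompact K)
    (hKΩ : K ⊆ Ω) :
    ∃ δ : ℝ, 0 < δ ∧ ∀ᶠ n in atTop, ∀ m : Fin d, ∀ y ∈ Metric.cthickening δ K,
      uBar (u (ε n)) (y + EuclideanSpace.single m (ε n * T)) - uBar (u (ε n)) y =
        ε n * T * cellGrad (u (ε n)) (cellIdx (ε n * T) y) m := by
  obtain ⟨δ, hδ, hsub⟩ := hK.exists_cthickening_subset_open hΩ hKΩ
  refine ⟨δ / 2, by positivity, ?_⟩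
  have hlim : Tendsto (fun n => 3 * (Real.sqrt d * (ε n * T)) + ε n * T) atTop (𝓝 0) := by
    have h1 := hε0.mul_const (T : ℝ)
    simpa using ((h1.const_mul (Real.sqrt d)).const_mul 3).add h1
  filter_upwards [hlim.eventually_lt_const (show (0 : ℝ) < δ / 2 by positivity)] with n hn m y hy
  refine uBar_add_single_sub hT hΩ (hε n) hn (u (ε n)) (fun x hx => hsub ?_) m
  have h1 : x ∈ Metric.cthickening (δ / 2) (Metric.cthickening (δ / 2) K) :=
    Metric.mem_cthickening_of_dist_le x y _ _ hy (Metric.mem_ball.1 hx).le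
  have h2 := Metric.cthickening_cthickening_subset (show 0 ≤ δ / 2 by positivity)
    (show 0 ≤ δ / 2 by positivity) K h1
  rwa [add_halves] at h2

/-- Strong local convergence from weak convergence: the discrete gradient bound controls the
translations of `ū_ε` near a compact set. -/
theorem IsAdmissible.tendsto_eLpNorm_uBar_sub (hX : IsAdmissible T X) (hΩ : IsOpen Ω)
    (u : ∀ ε : ℝ, scaledNodes T X Ω ε → ℝ) {ε : ℕ → ℝ} (hε : ∀ n, 0 < ε n)
    (hε0 : Tendsto ε atTop (𝓝 0)) {B : ℝ≥0} (hB : ∀ n, eLpNorm (uBar (u (ε n))) 2 volume ≤ B)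
    (hBg : ∀ n, eLpNorm (fun x => cellGrad (u (ε n)) (cellIdx (ε n * T) x)) 2 volume ≤ B)
    {v : EuclideanSpace ℝ (Fin d) → ℝ} (hvm : Measurable v) (hv : MemLp v 2 volume)
    (hweak : ∀ w : EuclideanSpace ℝ (Fin d) → ℝ, MemLp w 2 volume →
      Tendsto (fun n => ∫ x, uBar (u (ε n)) x * w x) atTop (𝓝 (∫ x, v x * w x)))
    {K : Set (EuclideanSpace ℝ (Fin d))} (hK : IsCompact K) (hKΩ : K ⊆ Ω) :
    Tendsto (fun n => eLpNorm (fun x => uBar (u (ε n)) x - v x) 2 (volume.restrict K)) atTop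
      (𝓝 0) := by
  have hT := hX.period_pos
  have hT' : (0 : ℝ) < T := by exact_mod_cast hT
  have hm : ∀ n, Measurable (uBar (u (ε n))) := fun n => measurable_uBar hT (hε n) _
  obtain ⟨δ₀, hδ₀, hstep⟩ := exists_eventually_uBar_add_single_sub hT hΩ u hε hε0 hK hKΩ
  refine tendsto_eLpNorm_restrict_of_weak_of_translate hm
    (fun n => ⟨(hm n).aestronglyMeasurable, (hB n).trans_lt ENNReal.coe_lt_top⟩) hvm hv hB hweak
    hK.measure_lt_top.ne fun δ hδ r hr => ?_
  obtain ⟨H, hH, hH1, hH2, hH3⟩ : ∃ H : ℝ, 0 < H ∧ d * H < δ₀ ∧ Real.sqrt d * H < r ∧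
      d * (ENNReal.ofReal (H + H) * B) ≤ δ := by
    have hid : Tendsto (fun H : ℝ => H) (𝓝[>] 0) (𝓝 0) := nhdsWithin_le_nhds
    have h1 : Tendsto (fun H : ℝ => d * H) (𝓝[>] 0) (𝓝 0) := by simpa using hid.const_mul (d : ℝ)
    have h2 : Tendsto (fun H : ℝ => Real.sqrt d * H) (𝓝[>] 0) (𝓝 0) := by
      simpa using hid.const_mul (Real.sqrt d)
    have h3 : Tendsto (fun H : ℝ => d * (ENNReal.ofReal (H + H) * B)) (𝓝[>] 0) (𝓝 0) := by
      have h4 := ENNReal.tendsto_ofReal (hid.add hid)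
      have h5 := ENNReal.Tendsto.const_mul (a := (d : ℝ≥0∞)) (ENNReal.Tendsto.mul_const (b := B) h4
        (Or.inr ENNReal.coe_ne_top)) (Or.inr (ENNReal.natCast_ne_top d))
      simpa using h5
    obtain ⟨H, h1, h2, h3, h4⟩ := ((h1.eventually_lt_const hδ₀).and
      ((h2.eventually_lt_const hr).and ((ENNReal.tendsto_nhds_zero.1 h3 δ hδ).and
        self_mem_nhdsWithin))).exists
    exact ⟨H, h4, h1, h2, h3⟩
  set S : Set (EuclideanSpace ℝ (Fin d)) := {z | ∀ m, z m ∈ Ioo 0 H} with hS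
  have hSo : IsOpen S := by
    simp only [hS, Set.ofPred_forall]
    exact isOpen_iInter_of_finite fun m =>
      isOpen_Ioo.preimage (by fun_prop : Continuous fun z : EuclideanSpace ℝ (Fin d) => z m)
  have hSne : S.Nonempty := by
    refine ⟨WithLp.toLp 2 fun _ => H / 2, fun m => ?_⟩
    simp only [mem_Ioo]
    constructor <;> linarith
  refine ⟨S, fun z hz => ?_, hSo.measurableSet, (hSo.measure_pos volume hSne).ne', ?_⟩
  · rw [mem_ball_zero_iff]
    refine (norm_le_of_forall_abs_le hH.le z fun m => ?_).trans_lt hH2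
    rw [abs_of_pos (hz m).1]
    exact (hz m).2.le
  · have hlim : Tendsto (fun n => ε n * T) atTop (𝓝 0) := by simpa using hε0.mul_const (T : ℝ)
    filter_upwards [hstep, hlim.eventually_lt_const hH] with n hn hnH z hz
    refine (eLpNorm_translate_sub_le (measurable_cellGrad_comp (u (ε n)) (ε n * T))
      hK.measurableSet (H := H) (mul_pos (hε n) hT') (fun x hx y hy => ?_) hn
      (fun m y r hr hrh => uBar_add_single_of_lt hT (hε n) hr hrh _ y m) z
      fun m => Ioo_subset_Icc_self (hz m)).trans (le_trans ?_ hH3)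
    · exact Metric.mem_cthickening_of_dist_le y x _ _ hx (hy.trans hH1.le)
    · gcongr
      exact hBg n

end

end ThinLattice

theorem mainTheorem4 {d k : ℕ} (hd : 1 ≤ d) (hk : 1 ≤ k) (T : ℕ)
    (X : Set (ThinLattice.Node d k)) (hX : ThinLattice.IsAdmissible T X)
    (Ω : Set (EuclideanSpace ℝ (Fin d))) (hΩ : IsOpen Ω)
    (hΩ' : ThinLattice.HasLipschitzBoundary Ω)
    (M : ℝ) (hM : 0 < M)
    (u : ∀ ε : ℝ, ThinLattice.scaledNodes T X Ω ε → ℝ) (C : ℝ≥0)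
    (hmass : ∀ ε : ℝ, 0 < ε → ThinLattice.massSum (u ε) ≤ (C : ℝ≥0∞))
    (henergy : ∀ ε : ℝ, 0 < ε → ThinLattice.nnEnergy M (u ε) ≤ (C : ℝ≥0∞))
    (ε : ℕ → ℝ) (hε : ∀ n, 0 < ε n) (hε0 : Tendsto ε atTop (𝓝 0)) :
    ∃ (s : ℕ → ℕ) (v : EuclideanSpace ℝ (Fin d) → ℝ), StrictMono s ∧
      ThinLattice.MemH1 Ω v ∧
      ThinLattice.TendstoL2Loc Ω (fun n => ThinLattice.uBar (u (ε (s n)))) v := by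
  open ThinLattice in
  have hT := hX.period_pos
  have hT' : (0 : ℝ) < T := by exact_mod_cast hT
  set B : ℝ≥0 := NNReal.sqrt (T ^ d * C)
  have hB : ∀ n, eLpNorm (uBar (u (ε n))) 2 volume ≤ B :=
    fun n => hX.eLpNorm_uBar_le (hε n) _ (hmass _ (hε n))
  have hBg : ∀ n, eLpNorm (fun x => cellGrad (u (ε n)) (cellIdx (ε n * T) x)) 2 volume ≤ B :=
    fun n => hX.eLpNorm_cellGrad_le (hε n) hM _ (henergy _ (hε n))
  have hL : ∀ n, MemLp (uBar (u (ε n))) 2 volume := fun n =>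
    ⟨(measurable_uBar hT (hε n) _).aestronglyMeasurable, (hB n).trans_lt ENNReal.coe_lt_top⟩
  have hLg : ∀ n, MemLp (fun x => cellGrad (u (ε n)) (cellIdx (ε n * T) x)) 2 volume := fun n =>
    ⟨(measurable_cellGrad_comp _ _).aestronglyMeasurable, (hBg n).trans_lt ENNReal.coe_lt_top⟩
  obtain ⟨v, s₁, hs₁, hvm, hvL, hv⟩ := exists_subseq_tendsto_integral_inner _ hL B hB
  obtain ⟨G, s₂, hs₂, -, hGL, hG⟩ := exists_subseq_tendsto_integral_inner _
    (fun n => hLg (s₁ n)) B (fun n => hBg (s₁ n))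
  let s := s₁ ∘ s₂
  have hsm : StrictMono s := hs₁.comp hs₂
  have hεs0 : Tendsto (fun n => ε (s n)) atTop (𝓝 0) := hε0.comp hsm.tendsto_atTop
  have hweak : ∀ w : EuclideanSpace ℝ (Fin d) → ℝ, MemLp w 2 volume →
      Tendsto (fun n => ∫ x, uBar (u (ε (s n))) x * w x) atTop (𝓝 (∫ x, v x * w x)) := by
    intro w hw
    have h := (hv w hw).comp hs₂.tendsto_atTop
    simp only [RCLike.inner_apply, conj_trivial, mul_comm (w _)] at h
    exact h
  have hweakG : ∀ w : EuclideanSpace ℝ (Fin d) → ℝ, MemLp w 2 volume → ∀ m,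
      Tendsto (fun n => ∫ x, cellGrad (u (ε (s n))) (cellIdx (ε (s n) * T) x) m * w x) atTop
        (𝓝 (∫ x, G x m * w x)) := by
    intro w hw m
    have hw' : MemLp (fun x => EuclideanSpace.single m (w x)) 2 volume := by
      refine hw.of_le ?_ (Eventually.of_forall fun x => by simp)
      rw [funext fun x => single_eq_smul_single_one m (w x)]
      exact hw.1.smul_const _
    have h := hG _ hw'
    simp only [EuclideanSpace.inner_single_right, conj_trivial] at h
    simp only [mul_comm (w _)] at h
    exact h
  refine ⟨s, v, hsm, ⟨hvL.restrict Ω, G, hGL.restrict Ω, ?_⟩, fun K hK hKΩ =>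
    ⟨fun n => (hL (s n)).restrict K, hvL.restrict K, ?_⟩⟩
  · intro φ hφ hφc hφΩ m
    obtain ⟨δ, hδ, hstep⟩ := exists_eventually_uBar_add_single_sub hT hΩ u
      (fun n => hε (s n)) hεs0 hφc hφΩ
    have key := integral_mul_fderiv_eq_of_weak (fun n => hL (s n)) (fun n => hB (s n)) hweak hweakG
      (fun n => mul_pos (hε (s n)) hT') (by simpa using hεs0.mul_const (T : ℝ)) hφ hφc m
      (hstep.mono fun n hn x hx => hn m x (Metric.self_subset_cthickening _ hx))
    rw [setIntegral_eq_integral_of_forall_compl_eq_zero,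
      setIntegral_eq_integral_of_forall_compl_eq_zero]
    · exact key
    · intro x hx
      rw [image_eq_zero_of_notMem_tsupport fun h => hx (hφΩ h), mul_zero]
    · intro x hx
      rw [image_eq_zero_of_notMem_tsupport
        fun h => hx (hφΩ (tsupport_fderiv_subset ℝ h))]
      simp
  · exact hX.tendsto_eLpNorm_uBar_sub hΩ u (fun n => hε (s n)) hεs0 (fun n => hB (s n))
      (fun n => hBg (s n)) hvm.measurable hvL hweak hK hKΩ
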